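/- Let $g\ge 2$ and let $H_g=\mathrm{conv}\big((0,0),(0,2),(g+1,0),(g+1,1)\big)$, a lattice polygon with interior lattice points $(1,1),\dots,(g,1)$. Let $\mathcal T$ be the unimodular triangulation of $H_g$ with triangles $$\{(0,2),(j,1),(j+1,1)\},\quad \{(j,0),(j,1),(j+1,1)\},\quad \{(j,0),(j+1,0),(j+1,1)\}\qquad(0\le j\le g).$$ Let $\mathbb M_g$ be the moduli space of metric graphs of genus $g$, that is, the closed orthants $\mathbb R_{\ge0}^{3g-3}$ of edge lengths on the connected trivalent graphs of genus $g$, glued along isomorphisms of the (vertex-weighted) metric graphs obtained by contracting the edges of length $0$. The skeleton of a tropical plane curve (in the min convention, with edges measured by lattice length) is the metric graph obtained by deleting all rays, repeatedly deleting $1$-valent vertices with their edges, and concatenating edges at $2$-valent vertices. Let $\mathbb M_{\mathcal T}\subseteq\mathbb M_g$ be the closure of the set of skeletons of the tropical plane curves with Newton polygon $H_g$ that are dual to $\mathcal T$. Then $\mathcal T$ is regular, and the skeleton of every tropical curve dual to $\mathcal T$ is, as a graph, the bridgeless chain of $g$ loops: it has vertices $t_1,b_1,\dots,t_{g-1},b_{g-1}$,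 edges $t_jb_j$ of length $h_j$ $(1\le j\le g-1)$, edges $t_{j-1}t_j$ of length $u_j$ and $b_{j-1}b_j$ of length $w_j$ $(2\le j\le g-1)$, one further edge $t_1b_1$ of length $\ell_s$, and one further edge $t_{g-1}b_{g-1}$ of length $\ell_e$. Moreover, $\mathbb M_{\mathcal T}$ is exactly the set of points of $\mathbb M_g$ given by non-negative lengths on this graph such that 1. $u_j=w_j$ for $2\le j\le g-1$ (these are $g-2$ linear equations); 2. $h_1\le \ell_s\le 2h_1$ and $h_{g-1}\le \ell_e$; 3. $h_{j-1}+j\,u_j\le h_j\le h_{j-1}+(j+1)\,u_j$ for $2\le j\le g-1$. In particular, $\dim(\mathbb M_{\mathcal T})=2g-1$. -/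

import Mathlib

open scoped NNReal ENNReal

noncomputable section

namespace TropPlane

/-! ### Finite multigraphs (loops and parallel edges allowed) -/

/-- A multigraph with vertices in `V` and edge set `E`; a loop at `v` has ends `s(v, v)`. -/
structure Multigraph (V E : Type*) where
  ends : E → Sym2 V

namespace Multigraph

variable {V E V' E' : Type*}

open scoped Classical in
/-- The number of ends (0, 1, or 2 for a loop) that the edge `e` has at the vertex `v`. -/
def endCount (G : Multigraph V E) (e : E) (v : V) : ℕ :=
  (G.ends e).toMultiset.count v

/-- The valence of `v` in the subgraph with edge set `S` (a loop counts twice). -/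
def valence (G : Multigraph V E) (S : Set E) (v : V) : ℕ :=
  ∑ᶠ e ∈ S, G.endCount e v

/-- `φ` (on edges) and `ψ` (on vertices) form an isomorphism of multigraphs. -/
def IsIso (G : Multigraph V E) (G' : Multigraph V' E') (φ : E ≃ E') (ψ : V ≃ V') : Prop :=
  ∀ e, G'.ends (φ e) = (G.ends e).map ψ

/-- One round of pruning: remove from the subgraph with edge set `S` all its 1-valent vertices
together with their edges. -/
def prune (G : Multigraph V E) (S : Set E) : Set E :=
  {e ∈ S | ∀ v ∈ G.ends e, G.valence S v ≠ 1}

/-- The edges that survive iterated pruning. -/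
def core (G : Multigraph V E) : Set E :=
  ⋂ n : ℕ, G.prune^[n] Set.univ

/-- Two edges of the core that meet in a vertex which is 2-valent in the core. -/
def MeetAtTwoValent (G : Multigraph V E) (e e' : G.core) : Prop :=
  ∃ v, v ∈ G.ends e ∧ v ∈ G.ends e' ∧ G.valence G.core v = 2

/-- The metric graph `(G', len')` is the skeleton of the metric graph `(G, len)`: it arises from the
core of `G` by concatenating edges at all 2-valent vertices and adding their lengths. The vertices
of `G'` are (via `ψ`) the vertices of the core of valence at least 3; `π` sends an edge of the core
to the edge of `G'` into which it is concatenated. The ends of an edge of `G'` are the ends that the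
corresponding chain of edges of the core has at the vertices of valence at least 3. -/
def IsSkeleton (G : Multigraph V E) (len : E → ℝ) (G' : Multigraph V' E') (len' : E' → ℝ) : Prop :=
  ∃ (ψ : V' → V) (π : G.core → E'),
    Function.Injective ψ ∧ Set.range ψ = {v | 3 ≤ G.valence G.core v} ∧
    Function.Surjective π ∧
    (∀ e e', π e = π e' ↔ Relation.EqvGen G.MeetAtTwoValent e e') ∧
    (∀ x v', G'.endCount x v' = ∑ᶠ e ∈ π ⁻¹' {x}, G.endCount (e : E) (ψ v')) ∧
    (∀ x, len' x = ∑ᶠ e ∈ π ⁻¹' {x}, len (e : E))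

end Multigraph

/-! ### The moduli space of metric graphs of genus `g` -/

/-- A connected trivalent multigraph of genus `g` (for `g ≥ 2`), on standard vertex and edge sets:
with `2g - 2` vertices and `3g - 3` edges its first Betti number is `g`. -/
structure TrivalentGraph (g : ℕ) extends Multigraph (Fin (2 * g - 2)) (Fin (3 * g - 3)) where
  trivalent : ∀ v, toMultigraph.valence Set.univ v = 3
  connected : ∀ u v, Relation.ReflTransGen (fun a b => ∃ e, toMultigraph.ends e = s(a, b)) u v

/-- A trivalent graph of genus `g` with non-negative edge lengths. These form the disjoint union of
the closed orthants of dimension `3g - 3`, one for each trivalent graph. An edge of length zero is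
contracted; a vertex of the contracted graph carries as weight the genus that was contracted
into it. -/
abbrev MetricModel (g : ℕ) : Type :=
  (_ : TrivalentGraph g) × (Fin (3 * g - 3) → ℝ≥0)

namespace MetricModel

variable {g : ℕ}

/-- Vertices joined by an edge of length zero. -/
def ZeroAdj (x : MetricModel g) (u v : Fin (2 * g - 2)) : Prop :=
  ∃ e, x.2 e = 0 ∧ x.1.ends e = s(u, v)

/-- The vertices of the contracted graph: the connected components of the subgraph formed by all
vertices and the edges of length zero. -/
def Vertex (x : MetricModel g) : Type := Quot x.ZeroAdj

/-- The edges of the contracted graph. -/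
def Edge (x : MetricModel g) : Type := {e : Fin (3 * g - 3) // x.2 e ≠ 0}

/-- The ends of an edge of the contracted graph. -/
def ends (x : MetricModel g) (e : x.Edge) : Sym2 x.Vertex :=
  (x.1.ends e.1).map (Quot.mk x.ZeroAdj)

/-- The weight of a vertex of the contracted graph: the first Betti number of the contracted
connected subgraph. -/
def weight (x : MetricModel g) (c : x.Vertex) : ℤ :=
  (Nat.card {e // x.2 e = 0 ∧ ∀ v ∈ x.1.ends e, Quot.mk x.ZeroAdj v = c} : ℤ)
    - (Nat.card {v // Quot.mk x.ZeroAdj v = c} : ℤ) + 1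

/-- The contracted vertex-weighted metric graphs are isomorphic. -/
def Equivalent (x y : MetricModel g) : Prop :=
  ∃ (φ : x.Edge ≃ y.Edge) (ψ : x.Vertex ≃ y.Vertex),
    (∀ e, y.2 (φ e).1 = x.2 e.1) ∧
    (∀ e, y.ends (φ e) = (x.ends e).map ψ) ∧
    (∀ c, y.weight (ψ c) = x.weight c)

/-- Isomorphism of contracted weighted metric graphs is an equivalence relation. -/
theorem equivalence_equivalent (g : ℕ) : Equivalence (Equivalent (g := g)) where
  refl x := ⟨Equiv.refl _, Equiv.refl _, fun _ => rfl, fun e => by simp, fun _ => rfl⟩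
  symm := by
    rintro x y ⟨φ, ψ, h1, h2, h3⟩
    refine ⟨φ.symm, ψ.symm, fun e => ?_, fun e => ?_, fun c => ?_⟩
    · have := h1 (φ.symm e); rw [Equiv.apply_symm_apply] at this; exact this.symm
    · have := h2 (φ.symm e)
      rw [Equiv.apply_symm_apply] at this
      rw [this, Sym2.map_map]; simp
    · have := h3 (ψ.symm c); rw [Equiv.apply_symm_apply] at this; exact this.symm
  trans := by
    rintro x y z ⟨φ, ψ, h1, h2, h3⟩ ⟨φ', ψ', h1', h2', h3'⟩
    refine ⟨φ.trans φ', ψ.trans ψ', fun e => ?_, fun e => ?_, fun c => ?_⟩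
    · exact (h1' (φ e)).trans (h1 e)
    · have := h2' (φ e)
      rw [h2 e, Sym2.map_map] at this
      exact this
    · exact (h3' (ψ c)).trans (h3 c)

def setoid (g : ℕ) : Setoid (MetricModel g) := ⟨Equivalent, equivalence_equivalent g⟩

end MetricModel

/-- The moduli space of metric graphs of genus `g`: the closed orthants of the trivalent graphs,
glued along isomorphisms of metric graphs, with the quotient topology. -/
abbrev Moduli (g : ℕ) : Type := Quotient (MetricModel.setoid g)

/-- The point of the moduli space given by edge lengths `ℓ` on a trivalent graph `G`. -/
def Moduli.point {g : ℕ} (G : TrivalentGraph g) (ℓ : Fin (3 * g - 3) → ℝ≥0) : Moduli g :=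
  Quotient.mk _ (⟨G, ℓ⟩ : MetricModel g)

/-- The dimension of a locus in the moduli space: the largest (Hausdorff) dimension of its inverse
images in the orthants. For polyhedral loci this is the dimension as a polyhedral space, since the
maps from the orthants to the moduli space have finite fibres. -/
def Moduli.dim {g : ℕ} (S : Set (Moduli g)) : ℝ≥0∞ :=
  ⨆ G : TrivalentGraph g, dimH {ℓ : Fin (3 * g - 3) → ℝ≥0 | Moduli.point G ℓ ∈ S}

/-! ### Tropical plane curves -/

/-- The inclusion of the lattice in the plane. -/
def toPlane (a : ℤ × ℤ) : ℝ × ℝ := ((a.1 : ℝ), (a.2 : ℝ))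

/-- The lattice points of a polygon. -/
def latticePoints (Δ : Set (ℝ × ℝ)) : Set (ℤ × ℤ) := {a | toPlane a ∈ Δ}

/-- The value at `p = (x, y)` of the term `ω(i,j) ⊙ x^i ⊙ y^j`, that is `ω(i,j) + i x + j y`. -/
def term (ω : ℤ × ℤ → ℝ) (p : ℝ × ℝ) (a : ℤ × ℤ) : ℝ :=
  ω a + (a.1 : ℝ) * p.1 + (a.2 : ℝ) * p.2

/-- The exponents of the terms at which the tropical polynomial with exponents in `A` and
coefficients `ω` (only the values of `ω` on `A` matter) attains its minimum at `p`. Equivalently,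
the points of `A` whose lifts `(a, ω a)` lie on the face of the lower convex hull that is minimal in
direction `(p, 1)`. -/
def minTerms (A : Set (ℤ × ℤ)) (ω : ℤ × ℤ → ℝ) (p : ℝ × ℝ) : Set (ℤ × ℤ) :=
  {a ∈ A | ∀ b ∈ A, term ω p a ≤ term ω p b}

/-- The tropical curve: the points where the minimum is attained at least twice. -/
def tropicalCurve (A : Set (ℤ × ℤ)) (ω : ℤ × ℤ → ℝ) : Set (ℝ × ℝ) :=
  {p | (minTerms A ω p).Nontrivial}

/-- The vertices of the tropical curve as a polyhedral complex: the points dual to the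
two-dimensional cells of the subdivision. -/
def curveVertices (A : Set (ℤ × ℤ)) (ω : ℤ × ℤ → ℝ) : Set (ℝ × ℝ) :=
  {p ∈ tropicalCurve A ω | ¬ Collinear ℝ (toPlane '' minTerms A ω p)}

/-- The height function `ω` induces the triangulation of `Δ` whose two-dimensional cells have the
vertex sets listed in `T`, each cell having no lattice points besides its vertices; equivalently,
the tropical curve with coefficients `ω` and Newton polygon `Δ` is dual to `T`. -/
def Induces (Δ : Set (ℝ × ℝ)) (ω : ℤ × ℤ → ℝ) (T : Set (Set (ℤ × ℤ))) : Prop :=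
  minTerms (latticePoints Δ) ω '' curveVertices (latticePoints Δ) ω = T

/-- The bounded edges of the tropical curve, given by their two end points: distinct vertices of the
curve that lie in a common one-dimensional cell `{p | a and b are both minimal at p}`. -/
def BoundedEdge (A : Set (ℤ × ℤ)) (ω : ℤ × ℤ → ℝ) : Type :=
  {e : Sym2 (ℝ × ℝ) // ∃ p q, e = s(p, q) ∧ p ≠ q ∧ p ∈ curveVertices A ω ∧ q ∈ curveVertices A ω ∧
    (minTerms A ω p ∩ minTerms A ω q).Nontrivial}

/-- The graph formed by the bounded edges of the tropical curve (all rays removed). -/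
def curveGraph (A : Set (ℤ × ℤ)) (ω : ℤ × ℤ → ℝ) : Multigraph (ℝ × ℝ) (BoundedEdge A ω) where
  ends e := e.1

/-- The lattice length of a vector `v = L n` with `L ≥ 0` and `n` a primitive integer vector is `L`
(the only element of the set). -/
def latticeLength (v : ℝ × ℝ) : ℝ :=
  sInf {L : ℝ | 0 ≤ L ∧ ∃ n : ℤ × ℤ, IsCoprime n.1 n.2 ∧ v = L • toPlane n}

theorem latticeLength_neg (v : ℝ × ℝ) : latticeLength (-v) = latticeLength v := by
  have key : ∀ w : ℝ × ℝ, ∀ L : ℝ, (∃ n : ℤ × ℤ, IsCoprime n.1 n.2 ∧ w = L • toPlane n) →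
      ∃ n : ℤ × ℤ, IsCoprime n.1 n.2 ∧ -w = L • toPlane n := by
    rintro w L ⟨n, hn, rfl⟩
    refine ⟨-n, hn.neg_neg, ?_⟩
    ext <;> simp [toPlane]
  unfold latticeLength
  congr 1
  ext L
  constructor
  · rintro ⟨h0, h⟩
    exact ⟨h0, by simpa using key _ _ h⟩
  · rintro ⟨h0, h⟩
    exact ⟨h0, key _ _ h⟩

/-- The lattice length of a bounded edge. -/
def edgeLength (A : Set (ℤ × ℤ)) (ω : ℤ × ℤ → ℝ) (e : BoundedEdge A ω) : ℝ :=
  Sym2.lift ⟨fun p q => latticeLength (q - p), fun p q => by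
    dsimp only
    rw [← latticeLength_neg, neg_sub]⟩ e.1

/-- `(G, ℓ)` is the skeleton of the tropical curve with Newton polygon `Δ` and coefficients `ω`. -/
def IsCurveSkeleton {g : ℕ} (Δ : Set (ℝ × ℝ)) (ω : ℤ × ℤ → ℝ) (G : TrivalentGraph g)
    (ℓ : Fin (3 * g - 3) → ℝ≥0) : Prop :=
  (curveGraph (latticePoints Δ) ω).IsSkeleton (edgeLength (latticePoints Δ) ω) G.toMultigraph
    (fun e => (ℓ e : ℝ))

/-- The space of a triangulation `T` of `Δ`: the closure in the moduli space of the set of skeletons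
of tropical plane curves dual to `T`. -/
def triangulationModuli (g : ℕ) (Δ : Set (ℝ × ℝ)) (T : Set (Set (ℤ × ℤ))) : Set (Moduli g) :=
  closure {x | ∃ (ω : ℤ × ℤ → ℝ) (G : TrivalentGraph g) (ℓ : Fin (3 * g - 3) → ℝ≥0),
    Induces Δ ω T ∧ IsCurveSkeleton Δ ω G ℓ ∧ x = Moduli.point G ℓ}

/-! ### The polygon `H_g` and its triangulation -/

/-- `H_g = conv((0,0), (0,2), (g+1,0), (g+1,1))`. -/
def polygonH (g : ℕ) : Set (ℝ × ℝ) :=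
  convexHull ℝ {(0, 0), (0, 2), ((g : ℝ) + 1, 0), ((g : ℝ) + 1, 1)}

/-- The triangles cut out by the edges `(j,1)(j+1,1)`, `(0,2)(j,1)`, `(j,0)(j,1)`, `(j,0)(j+1,1)`. -/
def triangulationH (g : ℕ) : Set (Set (ℤ × ℤ)) :=
  {σ | ∃ j : ℤ, 0 ≤ j ∧ j ≤ g ∧
    (σ = {(0, 2), (j, 1), (j + 1, 1)} ∨
     σ = {(j, 0), (j, 1), (j + 1, 1)} ∨
     σ = {(j, 0), (j + 1, 0), (j + 1, 1)})}

/-! ### The bridgeless chain of loops -/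

/-- The edges of the bridgeless chain of `g` loops. With the usual numbering from 1: `first` and
`last` are the edges of length `ℓ_s`, `ℓ_e` that complete the first and the last cycle; `h j` is
the common edge `h_{j+1}` of the cycles `j+1` and `j+2`; `u k`, `w k` are the upper and lower
edges `u_{k+2}`, `w_{k+2}` of the cycle `k+2`. -/
inductive ChainEdge (g : ℕ) : Type
  | first : ChainEdge g
  | last : ChainEdge g
  | h : Fin (g - 1) → ChainEdge g
  | u : Fin (g - 2) → ChainEdge g
  | w : Fin (g - 2) → ChainEdge g

/-- The index of the common edge on the left of the cycle `k+2`. -/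
def leftIdx {g : ℕ} (k : Fin (g - 2)) : Fin (g - 1) := ⟨k, by omega⟩

/-- The index of the common edge on the right of the cycle `k+2`. -/
def rightIdx {g : ℕ} (k : Fin (g - 2)) : Fin (g - 1) := ⟨k + 1, by omega⟩

/-- The bridgeless chain of `g ≥ 2` loops. The vertices `(j, true)` and `(j, false)` are the upper
and the lower end of the common edge `h j`. -/
def chainGraph (g : ℕ) (hg : 2 ≤ g) : Multigraph (Fin (g - 1) × Bool) (ChainEdge g) where
  ends
    | .first => s((⟨0, by omega⟩, true), (⟨0, by omega⟩, false))
    | .last => s((⟨g - 2, by omega⟩, true), (⟨g - 2, by omega⟩, false))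
    | .h j => s((j, true), (j, false))
    | .u k => s((leftIdx k, true), (rightIdx k, true))
    | .w k => s((leftIdx k, false), (rightIdx k, false))

/-- The conditions on non-negative edge lengths of the chain of loops: `u_j = w_j` for
`2 ≤ j ≤ g - 1`, `h_1 ≤ ℓ_s ≤ 2 h_1`, `h_{g-1} ≤ ℓ_e`, and
`h_{j-1} + j u_j ≤ h_j ≤ h_{j-1} + (j+1) u_j` for `2 ≤ j ≤ g - 1` (here `j = k + 2`). -/
def chainCone (g : ℕ) (hg : 2 ≤ g) : Set (ChainEdge g → ℝ≥0) :=
  {m | (∀ k : Fin (g - 2), m (.u k) = m (.w k)) ∧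
    (m (.h ⟨0, by omega⟩) ≤ m .first ∧ m .first ≤ 2 * m (.h ⟨0, by omega⟩)) ∧
    m (.h ⟨g - 2, by omega⟩) ≤ m .last ∧
    ∀ k : Fin (g - 2),
      m (.h (leftIdx k)) + ((k : ℕ) + 2) * m (.u k) ≤ m (.h (rightIdx k)) ∧
      m (.h (rightIdx k)) ≤ m (.h (leftIdx k)) + ((k : ℕ) + 3) * m (.u k)}

/-- The points of the moduli space given by edge lengths on the chain of loops that lie in a
set `K`. -/
def chainLocus (g : ℕ) (hg : 2 ≤ g) (K : Set (ChainEdge g → ℝ≥0)) : Set (Moduli g) :=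
  {x | ∃ (G : TrivalentGraph g) (ℓ : Fin (3 * g - 3) → ℝ≥0)
    (φ : ChainEdge g ≃ Fin (3 * g - 3)) (ψ : Fin (g - 1) × Bool ≃ Fin (2 * g - 2)),
    (chainGraph g hg).IsIso G.toMultigraph φ ψ ∧ (fun a => ℓ (φ a)) ∈ K ∧ x = Moduli.point G ℓ}

end TropPlane

end

/-! Write `s j`, `r j` for `slopeOne ω j`, `slopeZero ω j`. These are the first coordinates of the
curve vertices dual to the upper and middle triangles, respectively the lower triangle, with index
`j`. A height function induces the triangulation exactly when all `gap ω j` are positive and `s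
(j+1) < r j < s j` (`Admissible`, with `Admissible.induces` and `Induces.admissible`). These
inequalities say that the bounded edges of the curve have positive length: the vertical ones have
length `gap ω j`, an upper edge has length `s j - s (j+1)`, and the lower path splits into `s j - r
j` and `r j - s (j+1)`.

The two lower pieces add up to the upper edge, whence `u = w`. Everything else comes from the
recursion `gap_succ`, `gap (j+1) = gap j + (j+1) * (s j - s (j+1)) + (s j - r j)`, whose last term
lies strictly between `0` and `s j - s (j+1)`. With `h_j = gap j` and `u_j = s (j-1) - s j` this is
the strict form of the third condition; the two outer cycles give the second one. Conversely the
differences `s j - s (j+1)`, `s j - r j` and `gap 0` can be prescribed freely (`exists_heights`), so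
all lengths with `u = w` and strict inequalities occur (`exists_admissible`).

The skeleton is computed on the abstract dual graph (`isSkeleton_dualGraph`), carried over to the
curve (`IsSkeleton.of_embedding`), and is unique up to isometry (`IsSkeleton.unique`).

For the closure, `isClosed_chainLocus` shows that a closed set of lengths gives a closed locus in
the glued space: an isomorphism of contracted graphs persists under further degeneration, and there
are only finitely many combinatorial types of isomorphism. In the other direction a point of the
cone is perturbed along an interior direction. The dimension counts the coordinates left after `u =
w`, namely `(3g-3) - (g-2)`, since gluing only pulls lengths back along one of finitely many partial
maps of edges. -/

namespace TropPlane

/-! ### Degenerations of metric graphs -/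

namespace MetricModel

variable {g : ℕ}

/-- The vertex of the contracted graph into which a vertex is contracted. -/
def toVertex (x : MetricModel g) (v : Fin (2 * g - 2)) : x.Vertex := Quot.mk x.ZeroAdj v

/-- The edge that gives rise to an edge of the contracted graph. -/
def Edge.idx {x : MetricModel g} (e : x.Edge) : Fin (3 * g - 3) := Subtype.val e

/-- An edge of non-zero length as an edge of the contracted graph. -/
def mkEdge (x : MetricModel g) (e : Fin (3 * g - 3)) (h : x.2 e ≠ 0) : x.Edge := Subtype.mk e h

@[simp] theorem idx_mkEdge (x : MetricModel g) (e : Fin (3 * g - 3)) (h : x.2 e ≠ 0) :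
    (x.mkEdge e h).idx = e := rfl

theorem Edge.idx_ne {x : MetricModel g} (e : x.Edge) : x.2 e.idx ≠ 0 := Subtype.property e

@[simp] theorem mkEdge_idx {x : MetricModel g} (e : x.Edge) (h : x.2 e.idx ≠ 0) :
    x.mkEdge e.idx h = e := rfl

theorem toVertex_surjective (x : MetricModel g) : Function.Surjective x.toVertex :=
  Quot.mk_surjective

theorem toVertex_eq (x : MetricModel g) {e : Fin (3 * g - 3)} (he : x.2 e = 0)
    {u v : Fin (2 * g - 2)} (hs : x.1.ends e = s(u, v)) : x.toVertex u = x.toVertex v :=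
  Quot.sound ⟨e, he, hs⟩

theorem toVertex_eq_of_mem (x : MetricModel g) {e : Fin (3 * g - 3)} (he : x.2 e = 0)
    {u v : Fin (2 * g - 2)} (hu : u ∈ x.1.ends e) (hv : v ∈ x.1.ends e) :
    x.toVertex u = x.toVertex v := by
  obtain ⟨w, hw⟩ := hu
  rw [hw, Sym2.mem_iff] at hv
  rcases hv with rfl | rfl
  · rfl
  · exact x.toVertex_eq he hw

/-- A function on vertices that is constant along the contracted edges. -/
def liftVertex (x : MetricModel g) {α : Sort*} (f : Fin (2 * g - 2) → α)
    (hf : ∀ e u v, x.2 e = 0 → x.1.ends e = s(u, v) → f u = f v) : x.Vertex → α :=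
  Quot.lift f fun u v ⟨e, he, hs⟩ => hf e u v he hs

theorem ends_eq (x : MetricModel g) (e : x.Edge) :
    x.ends e = (x.1.ends e.idx).map x.toVertex := rfl

theorem weight_eq (x : MetricModel g) (c : x.Vertex) :
    x.weight c = (Nat.card {e // x.2 e = 0 ∧ ∀ v ∈ x.1.ends e, x.toVertex v = c} : ℤ)
      - (Nat.card {v // x.toVertex v = c} : ℤ) + 1 := rfl

theorem equivalent_iff {x y : MetricModel g} : Equivalent x y ↔
    ∃ (φ : x.Edge ≃ y.Edge) (ψ : x.Vertex ≃ y.Vertex),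
      (∀ e, y.2 (φ e).idx = x.2 e.idx) ∧
      (∀ e, y.ends (φ e) = (x.ends e).map ψ) ∧
      (∀ c, y.weight (ψ c) = x.weight c) := Iff.rfl

instance finite_vertex (x : MetricModel g) : Finite x.Vertex :=
  Finite.of_surjective _ x.toVertex_surjective

section Degenerate

variable {G C : TrivalentGraph g} {ℓ ℓ' m m' : Fin (3 * g - 3) → ℝ≥0}

/-- If every edge contracted under some lengths is also contracted under other lengths, then the
contracted graph for the latter is a contraction of that for the former. -/
def coarsen (G : TrivalentGraph g) {ℓ ℓ' : Fin (3 * g - 3) → ℝ≥0} (h : ∀ e, ℓ e = 0 → ℓ' e = 0) :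
    Vertex ⟨G, ℓ⟩ → Vertex ⟨G, ℓ'⟩ :=
  liftVertex _ (toVertex _) fun e _ _ he hs => toVertex_eq _ (h e he) hs

@[simp] theorem coarsen_toVertex (h : ∀ e, ℓ e = 0 → ℓ' e = 0) (v : Fin (2 * g - 2)) :
    coarsen G h (toVertex _ v) = toVertex _ v := rfl

/-- The map of vertices induced on further contractions by a map of contracted graphs. -/
def degenerateVertex (hm : ∀ e, m e = 0 → m' e = 0)
    (φ : Edge ⟨G, ℓ⟩ → Edge ⟨C, m⟩) (ψ : Vertex ⟨G, ℓ⟩ → Vertex ⟨C, m⟩)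
    (hends : ∀ e, ends ⟨C, m⟩ (φ e) = (ends ⟨G, ℓ⟩ e).map ψ)
    (hlen : ∀ e, m' (φ e).idx = ℓ' e.idx) : Vertex ⟨G, ℓ'⟩ → Vertex ⟨C, m'⟩ :=
  liftVertex _ (fun v => coarsen C hm (ψ (toVertex _ v))) <| by
    intro e u v he hs
    by_cases h0 : ℓ e = 0
    · rw [toVertex_eq ⟨G, ℓ⟩ h0 hs]
    -- The edge `e` survives under `ℓ` but is contracted under `ℓ'`. Its image is contracted under
    -- `m'`, and this identifies the images of its two ends.
    · have h1 := hends (mkEdge _ e h0)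
      have h2 : m' (φ (mkEdge _ e h0)).idx = 0 := (hlen (mkEdge _ e h0)).trans he
      simp only at hs
      rw [ends_eq, ends_eq, idx_mkEdge, hs] at h1
      obtain ⟨a, b, hab⟩ : ∃ a b, C.ends (φ (mkEdge _ e h0)).idx = s(a, b) :=
        ⟨_, _, (Quot.out_eq (C.ends (φ (mkEdge _ e h0)).idx)).symm⟩
      have h3 : toVertex ⟨C, m'⟩ a = toVertex ⟨C, m'⟩ b := toVertex_eq ⟨C, m'⟩ h2 hab
      rw [hab, Sym2.map_mk, Sym2.map_mk, Sym2.map_mk, Sym2.eq_iff] at h1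
      rcases h1 with ⟨h, h'⟩ | ⟨h, h'⟩
      · rw [← h, ← h']; exact h3
      · rw [← h, ← h']; exact h3.symm

theorem degenerateVertex_coarsen (hm : ∀ e, m e = 0 → m' e = 0) (hl : ∀ e, ℓ e = 0 → ℓ' e = 0)
    (φ : Edge ⟨G, ℓ⟩ → Edge ⟨C, m⟩) (ψ : Vertex ⟨G, ℓ⟩ → Vertex ⟨C, m⟩)
    (hends : ∀ e, ends ⟨C, m⟩ (φ e) = (ends ⟨G, ℓ⟩ e).map ψ)
    (hlen : ∀ e, m' (φ e).idx = ℓ' e.idx) (c : Vertex ⟨G, ℓ⟩) :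
    degenerateVertex hm φ ψ hends hlen (coarsen G hl c) = coarsen C hm (ψ c) := by
  obtain ⟨v, rfl⟩ := toVertex_surjective _ c
  rfl

theorem coarsen_surjective (hl : ∀ e, ℓ e = 0 → ℓ' e = 0) :
    Function.Surjective (coarsen G hl) := by
  intro c
  obtain ⟨v, rfl⟩ := toVertex_surjective _ c
  exact ⟨toVertex _ v, rfl⟩

/-- The Euler characteristic of a contracted subgraph, computed after a partial contraction. -/
theorem weight_coarsen (hl : ∀ e, ℓ e = 0 → ℓ' e = 0) (c : Vertex ⟨G, ℓ'⟩) [Fintype (Vertex ⟨G, ℓ⟩)]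
    [DecidablePred fun d => coarsen G hl d = c] :
    weight ⟨G, ℓ'⟩ c - 1 = ∑ d : Vertex ⟨G, ℓ⟩ with coarsen G hl d = c, (weight ⟨G, ℓ⟩ d - 1) +
      (Nat.card {e : Edge ⟨G, ℓ⟩ // ℓ' e.idx = 0 ∧
        ∀ d ∈ ends ⟨G, ℓ⟩ e, coarsen G hl d = c} : ℤ) := by
  classical
  -- `weight - 1` is the number of edges minus the number of vertices, so it is enough to partition
  -- both. The vertices over `c` split according to their component in the partial contraction.
  have hV : Nat.card {v // toVertex ⟨G, ℓ'⟩ v = c} =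
      ∑ d : Vertex ⟨G, ℓ⟩ with coarsen G hl d = c, Nat.card {v // toVertex ⟨G, ℓ⟩ v = d} := by
    simp only [Nat.card_eq_fintype_card, Fintype.card_subtype]
    rw [Finset.card_eq_sum_card_fiberwise (f := toVertex ⟨G, ℓ⟩)
      (t := Finset.univ.filter fun d => coarsen G hl d = c)]
    · refine Finset.sum_congr rfl fun d hd => ?_
      congr 1
      ext v
      simp only [Finset.mem_filter, Finset.mem_univ, true_and] at hd ⊢
      refine ⟨fun h => h.2, fun h => ⟨?_, h⟩⟩
      subst h
      exact hd
    · intro v hv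
      simpa using hv
  -- The edges over `c` either are contracted already under `ℓ`, and then lie in a single component
  -- `d`, or are edges of the partially contracted graph.
  have hE : Nat.card {e // ℓ' e = 0 ∧ ∀ v ∈ G.ends e, toVertex ⟨G, ℓ'⟩ v = c} =
      ∑ d : Vertex ⟨G, ℓ⟩ with coarsen G hl d = c,
        Nat.card {e // ℓ e = 0 ∧ ∀ v ∈ G.ends e, toVertex ⟨G, ℓ⟩ v = d} +
      Nat.card {e : Edge ⟨G, ℓ⟩ // ℓ' e.idx = 0 ∧
        ∀ d ∈ ends ⟨G, ℓ⟩ e, coarsen G hl d = c} := by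
    have h1 : Nat.card {e : Edge ⟨G, ℓ⟩ // ℓ' e.idx = 0 ∧
        ∀ d ∈ ends ⟨G, ℓ⟩ e, coarsen G hl d = c} =
        Nat.card {e // ℓ e ≠ 0 ∧ ℓ' e = 0 ∧ ∀ v ∈ G.ends e, toVertex ⟨G, ℓ'⟩ v = c} := by
      refine Nat.card_congr ⟨fun e => ⟨e.1.idx, e.1.idx_ne, e.2.1,
          fun v hv => e.2.2 (toVertex _ v) ?_⟩,
        fun e => ⟨mkEdge _ e.1 e.2.1, e.2.2.1, ?_⟩, fun e => rfl, fun e => rfl⟩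
      · exact Sym2.mem_map.2 ⟨v, hv, rfl⟩
      · intro d hd
        obtain ⟨v, hv, rfl⟩ := Sym2.mem_map.1 hd
        exact e.2.2.2 v hv
    -- A chosen end of each edge names the component that contains it; for a contracted edge either
    -- end gives the same one.
    have h2 : ∀ e : Fin (3 * g - 3), ∃ v, v ∈ G.ends e := fun e => ⟨_, Sym2.out_fst_mem _⟩
    choose v hv using h2
    rw [h1]
    simp only [Nat.card_eq_fintype_card, Fintype.card_subtype]
    rw [← Finset.card_filter_add_card_filter_not (fun e => ℓ e = 0),
      Finset.filter_filter, Finset.filter_filter]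
    congr 1
    · rw [Finset.card_eq_sum_card_fiberwise
        (f := fun e => toVertex ⟨G, ℓ⟩ (v e))
        (t := Finset.univ.filter fun d => coarsen G hl d = c)]
      · refine Finset.sum_congr rfl fun d hd => ?_
        congr 1
        ext e
        simp only [Finset.mem_filter, Finset.mem_univ, true_and] at hd ⊢
        constructor
        · rintro ⟨⟨⟨_, _⟩, h0⟩, rfl⟩
          exact ⟨h0, fun w hw => toVertex_eq_of_mem ⟨G, ℓ⟩ h0 hw (hv e)⟩
        · rintro ⟨h0, h⟩
          refine ⟨⟨⟨hl _ h0, fun w hw => ?_⟩, h0⟩, h _ (hv e)⟩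
          have := h w hw
          rw [← hd, ← this]
          rfl
      · intro e he
        simp only [Finset.coe_filter, Finset.mem_univ, true_and, Set.mem_ofPred_eq] at he ⊢
        exact he.1.2 _ (hv e)
    · congr 1
      ext e
      simp only [Finset.mem_filter, Finset.mem_univ, true_and]
      tauto
  simp only [weight_eq, hE, hV, add_sub_cancel_right, Finset.sum_sub_distrib]
  push_cast
  ring

/-- Equivalent models stay equivalent when further edges, corresponding to each other, are
contracted and the lengths are changed accordingly. -/
theorem Equivalent.degenerate (φ : Edge ⟨G, ℓ⟩ ≃ Edge ⟨C, m⟩) (ψ : Vertex ⟨G, ℓ⟩ ≃ Vertex ⟨C, m⟩)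
    (hends : ∀ e, ends ⟨C, m⟩ (φ e) = (ends ⟨G, ℓ⟩ e).map ψ)
    (hweight : ∀ c, weight ⟨C, m⟩ (ψ c) = weight ⟨G, ℓ⟩ c)
    (hl : ∀ e, ℓ e = 0 → ℓ' e = 0) (hm : ∀ e, m e = 0 → m' e = 0)
    (hlen : ∀ e, m' (φ e).idx = ℓ' e.idx) :
    Equivalent (⟨G, ℓ'⟩ : MetricModel g) ⟨C, m'⟩ := by
  classical
  have hends' : ∀ e, ends ⟨G, ℓ⟩ (φ.symm e) = (ends ⟨C, m⟩ e).map ψ.symm := by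
    intro e
    have := hends (φ.symm e)
    rw [Equiv.apply_symm_apply] at this
    rw [this, Sym2.map_map]; simp
  have hlen' : ∀ e, ℓ' (φ.symm e).idx = m' e.idx := by
    intro e
    rw [← hlen, Equiv.apply_symm_apply]
  let Ψ : Vertex ⟨G, ℓ'⟩ ≃ Vertex ⟨C, m'⟩ :=
    { toFun := degenerateVertex hm φ ψ hends hlen
      invFun := degenerateVertex hl φ.symm ψ.symm hends' hlen'
      left_inv := by
        intro c
        obtain ⟨d, rfl⟩ := coarsen_surjective hl c
        rw [degenerateVertex_coarsen, degenerateVertex_coarsen, Equiv.symm_apply_apply]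
      right_inv := by
        intro c
        obtain ⟨d, rfl⟩ := coarsen_surjective hm c
        rw [degenerateVertex_coarsen, degenerateVertex_coarsen, Equiv.apply_symm_apply] }
  have hΨ : ∀ d, Ψ (coarsen G hl d) = coarsen C hm (ψ d) :=
    degenerateVertex_coarsen hm hl φ ψ hends hlen
  let Φ : Edge ⟨G, ℓ'⟩ ≃ Edge ⟨C, m'⟩ :=
    { toFun := fun e => mkEdge _ (φ (mkEdge _ e.idx fun h => e.idx_ne (hl _ h))).idx
        ((hlen _).trans_ne e.idx_ne)
      invFun := fun e => mkEdge _ (φ.symm (mkEdge _ e.idx fun h => e.idx_ne (hm _ h))).idx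
        ((hlen' _).trans_ne e.idx_ne)
      left_inv := fun e => by simp
      right_inv := fun e => by simp }
  refine equivalent_iff.2 ⟨Φ, Ψ, fun e => hlen _, fun e => ?_, fun c => ?_⟩
  · have h1 := congrArg (Sym2.map (coarsen C hm))
      (hends (mkEdge _ e.idx fun h => e.idx_ne (hl _ h)))
    rw [ends_eq, ends_eq, idx_mkEdge, Sym2.map_map, Sym2.map_map, Sym2.map_map] at h1
    rw [ends_eq, ends_eq, Sym2.map_map]
    exact h1
  -- `weight_coarsen` expresses both weights through data of the partially contracted graphs, and
  -- `φ`, `ψ` match these data.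
  · have := Fintype.ofFinite (Vertex ⟨G, ℓ⟩)
    have := Fintype.ofFinite (Vertex ⟨C, m⟩)
    have h1 := weight_coarsen hl c
    have h2 := weight_coarsen hm (Ψ c)
    have h3 : ∑ d : Vertex ⟨C, m⟩ with coarsen C hm d = Ψ c, (weight ⟨C, m⟩ d - 1) =
        ∑ d : Vertex ⟨G, ℓ⟩ with coarsen G hl d = c, (weight ⟨G, ℓ⟩ d - 1) := by
      symm
      refine Finset.sum_equiv ψ (fun d => ?_) (fun d _ => by rw [hweight])
      simp only [Finset.mem_filter, Finset.mem_univ, true_and]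
      rw [← hΨ, Ψ.injective.eq_iff]
    have h4 : Nat.card {e : Edge ⟨C, m⟩ // m' e.idx = 0 ∧
          ∀ d ∈ ends ⟨C, m⟩ e, coarsen C hm d = Ψ c} =
        Nat.card {e : Edge ⟨G, ℓ⟩ // ℓ' e.idx = 0 ∧
          ∀ d ∈ ends ⟨G, ℓ⟩ e, coarsen G hl d = c} := by
      symm
      refine Nat.card_congr (φ.subtypeEquiv fun e => ?_)
      rw [hlen, hends]
      refine and_congr_right fun _ => ⟨fun h d hd => ?_, fun h d hd => ?_⟩
      · obtain ⟨d, hd', rfl⟩ := Sym2.mem_map.1 hd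
        rw [← hΨ, h d hd']
      · have := h (ψ d) (Sym2.mem_map.2 ⟨d, hd, rfl⟩)
        rwa [← hΨ, Ψ.injective.eq_iff] at this
    rw [h3, h4] at h2
    have := h1.trans h2.symm
    linarith

end Degenerate

/-- Lengths pulled back along a partial map of edges, edges without image being contracted. -/
def pullLen {α β : Type*} (f : β → Option α) (ℓ : α → ℝ≥0) (b : β) : ℝ≥0 := (f b).elim 0 ℓ

/-- An equivalence of models extends to all degenerations of the first model, the lengths on the
second one being a pull-back along a fixed partial map of edges. -/
theorem Equivalent.exists_pullLen {G C : TrivalentGraph g} {ℓ m : Fin (3 * g - 3) → ℝ≥0}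
    (h : Equivalent (⟨G, ℓ⟩ : MetricModel g) ⟨C, m⟩) :
    ∃ f : Fin (3 * g - 3) → Option (Fin (3 * g - 3)), m = pullLen f ℓ ∧
      ∀ ℓ' : Fin (3 * g - 3) → ℝ≥0, (∀ e, ℓ e = 0 → ℓ' e = 0) →
        Equivalent (⟨G, ℓ'⟩ : MetricModel g) ⟨C, pullLen f ℓ'⟩ := by
  classical
  obtain ⟨φ, ψ, h1, h2, h3⟩ := equivalent_iff.1 h
  refine ⟨fun e => if he : m e ≠ 0 then some (φ.symm (mkEdge _ e he)).idx else none, ?_,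
    fun ℓ' hl => ?_⟩
  · funext e
    by_cases he : m e = 0
    · simp [pullLen, he]
    · have := h1 (φ.symm (mkEdge _ e he))
      rw [Equiv.apply_symm_apply, idx_mkEdge] at this
      simpa [pullLen, he] using this
  · refine Equivalent.degenerate φ ψ h2 h3 hl (fun e he => by simp [pullLen, he]) (fun e => ?_)
    have he : m (φ e).idx ≠ 0 := (φ e).idx_ne
    simp [pullLen, he]

end MetricModel

/-! ### Closed sets of edge lengths and closed loci in the moduli space -/

instance finite_trivalentGraph (g : ℕ) : Finite (TrivalentGraph g) := by
  refine Finite.of_injective (β := Fin (3 * g - 3) → Sym2 (Fin (2 * g - 2)))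
    (fun G => G.ends) ?_
  rintro ⟨⟨e⟩, _, _⟩ ⟨⟨e'⟩, _, _⟩ h
  cases h
  rfl

/-- Edges of the chain of loops as a sum type. -/
def chainEdgeEquiv (g : ℕ) :
    (Bool ⊕ Fin (g - 1)) ⊕ (Fin (g - 2) ⊕ Fin (g - 2)) ≃ ChainEdge g where
  toFun
    | .inl (.inl true) => .first
    | .inl (.inl false) => .last
    | .inl (.inr j) => .h j
    | .inr (.inl k) => .u k
    | .inr (.inr k) => .w k
  invFun
    | .first => .inl (.inl true)
    | .last => .inl (.inl false)
    | .h j => .inl (.inr j)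
    | .u k => .inr (.inl k)
    | .w k => .inr (.inr k)
  left_inv := by rintro (((_ | _) | j) | (k | k)) <;> rfl
  right_inv := by rintro (_ | _ | j | k | k) <;> rfl

instance finite_chainEdge (g : ℕ) : Finite (ChainEdge g) :=
  Finite.of_equiv _ (chainEdgeEquiv g)

theorem continuous_pullLen {α β : Type*} (f : β → Option α) :
    Continuous (MetricModel.pullLen f) := by
  refine continuous_pi fun b => ?_
  unfold MetricModel.pullLen
  cases f b with
  | none => exact continuous_const
  | some a => exact continuous_apply a

theorem point_eq_point_iff {g : ℕ} {G C : TrivalentGraph g} {ℓ m : Fin (3 * g - 3) → ℝ≥0} :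
    Moduli.point G ℓ = Moduli.point C m ↔
      MetricModel.Equivalent (⟨G, ℓ⟩ : MetricModel g) ⟨C, m⟩ :=
  Quotient.eq (r := MetricModel.setoid g)

theorem continuous_point {g : ℕ} (G : TrivalentGraph g) : Continuous (Moduli.point G) :=
  continuous_quotient_mk'.comp (continuous_sigmaMk (i := G))

/-- A closed set of lengths on the chain of loops gives a closed set in the moduli space. -/
theorem isClosed_chainLocus (g : ℕ) (hg : 2 ≤ g) {K : Set (ChainEdge g → ℝ≥0)} (hK : IsClosed K) :
    IsClosed (chainLocus g hg K) := by
  rw [← isQuotientMap_quotient_mk'.isClosed_preimage, isClosed_sigma_iff]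
  intro G
  -- An index records the target graph, its identification with the chain, the partial map of edges
  -- and the set of contracted edges. Requiring the equivalence for all lengths that vanish on that
  -- set makes each piece a closed condition on `ℓ` alone. The index type is finite, so the union is
  -- closed.
  let I := {d : (TrivalentGraph g × (ChainEdge g ≃ Fin (3 * g - 3)) ×
    (Fin (g - 1) × Bool ≃ Fin (2 * g - 2))) × (Fin (3 * g - 3) → Option (Fin (3 * g - 3))) ×
      Set (Fin (3 * g - 3)) //
    (chainGraph g hg).IsIso d.1.1.toMultigraph d.1.2.1 d.1.2.2 ∧
    ∀ ℓ : Fin (3 * g - 3) → ℝ≥0, (∀ e ∈ d.2.2, ℓ e = 0) →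
      MetricModel.Equivalent (⟨G, ℓ⟩ : MetricModel g)
        ⟨d.1.1, MetricModel.pullLen d.2.1 ℓ⟩}
  have key : ((fun ℓ => (⟨G, ℓ⟩ : MetricModel g)) ⁻¹' ((fun x : MetricModel g => (Quotient.mk _ x : Moduli g)) ⁻¹'
        chainLocus g hg K) : Set (Fin (3 * g - 3) → ℝ≥0)) =
      ⋃ d : I, {ℓ | (∀ e ∈ d.1.2.2, ℓ e = 0) ∧
        (fun a => MetricModel.pullLen d.1.2.1 ℓ (d.1.1.2.1 a)) ∈ K} := by
    ext ℓ
    simp only [Set.mem_preimage, Set.mem_iUnion, Set.mem_ofPred_eq]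
    constructor
    · rintro ⟨C, m, φ, ψ, hiso, hmem, hx⟩
      obtain ⟨f, rfl, hf⟩ := (point_eq_point_iff.1 hx).exists_pullLen
      exact ⟨⟨⟨⟨C, φ, ψ⟩, f, {e | ℓ e = 0}⟩, hiso, hf⟩, fun e he => he, hmem⟩
    · rintro ⟨⟨⟨⟨C, φ, ψ⟩, f, Z⟩, hiso, hf⟩, hZ, hmem⟩
      exact ⟨C, MetricModel.pullLen f ℓ, φ, ψ, hiso, hmem, point_eq_point_iff.2 (hf ℓ hZ)⟩
  refine Eq.subst (motive := IsClosed) key.symm (isClosed_iUnion_of_finite fun d => ?_)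
  refine IsClosed.inter (s₁ := {ℓ : Fin (3 * g - 3) → ℝ≥0 | ∀ e ∈ d.1.2.2, ℓ e = 0}) ?_ ?_
  · simp only [Set.ofPred_forall]
    exact isClosed_iInter fun e => isClosed_iInter fun _ =>
      isClosed_eq (continuous_apply e) continuous_const
  · refine hK.preimage (continuous_pi fun a => ?_)
    exact (continuous_apply (d.1.1.2.1 a)).comp (continuous_pullLen d.1.2.1)

/-! ### Skeletons: uniqueness and transport along isomorphisms -/

namespace Multigraph

variable {V E W F V₁ E₁ V₂ E₂ : Type*}

open scoped Classical in
theorem endCount_eq {G : Multigraph V E} {e : E} {a b : V} (h : G.ends e = s(a, b)) (v : V) :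
    G.endCount e v = (if a = v then 1 else 0) + (if b = v then 1 else 0) := by
  unfold endCount
  rw [h]
  have : Sym2.toMultiset s(a, b) = {a, b} := rfl
  rw [this, Multiset.insert_eq_cons, Multiset.count_cons, Multiset.count_singleton, add_comm]
  simp only [eq_comm]

/-- An unordered pair is determined by its multiplicities. `IsSkeleton` prescribes ends only through
end counts, so this is what recovers the graph. -/
theorem ends_eq_of_endCount {G : Multigraph V E} {H : Multigraph V F} {e : E} {f : F}
    (h : ∀ v, G.endCount e v = H.endCount f v) : G.ends e = H.ends f := by
  classical
  obtain ⟨a, b, hab⟩ : ∃ a b, G.ends e = s(a, b) := ⟨_, _, (Quot.out_eq (G.ends e)).symm⟩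
  obtain ⟨c, d, hcd⟩ : ∃ c d, H.ends f = s(c, d) := ⟨_, _, (Quot.out_eq (H.ends f)).symm⟩
  rw [hab, hcd, Sym2.eq_iff]
  have ha := h a
  have hb := h b
  rw [endCount_eq hab, endCount_eq hcd] at ha hb
  by_cases h1 : c = a <;> by_cases h2 : d = a <;> by_cases h3 : c = b <;> by_cases h4 : d = b <;>
    simp_all

theorem endCount_map {G : Multigraph V E} {H : Multigraph W F} {e : E} {f : F} {ι : V → W}
    (hι : Function.Injective ι) (h : H.ends f = (G.ends e).map ι) (v : V) :
    H.endCount f (ι v) = G.endCount e v := by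
  classical
  obtain ⟨a, b, hab⟩ : ∃ a b, G.ends e = s(a, b) := ⟨_, _, (Quot.out_eq (G.ends e)).symm⟩
  have h' : H.ends f = s(ι a, ι b) := by rw [h, hab, Sym2.map_mk]
  rw [endCount_eq hab, endCount_eq h']
  exact congrArg₂ _ (if_congr hι.eq_iff rfl rfl) (if_congr hι.eq_iff rfl rfl)

theorem endCount_eq_zero {G : Multigraph V E} {e : E} {v : V} (h : v ∉ G.ends e) :
    G.endCount e v = 0 := by
  obtain ⟨a, b, hab⟩ : ∃ a b, G.ends e = s(a, b) := ⟨_, _, (Quot.out_eq (G.ends e)).symm⟩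
  rw [endCount_eq hab]
  rw [hab, Sym2.mem_iff, not_or] at h
  rw [if_neg (Ne.symm h.1), if_neg (Ne.symm h.2)]

/-- The skeleton of a metric graph is unique up to isometry. -/
theorem IsSkeleton.unique {G : Multigraph V E} {len : E → ℝ} {G₁ : Multigraph V₁ E₁}
    {len₁ : E₁ → ℝ} {G₂ : Multigraph V₂ E₂} {len₂ : E₂ → ℝ} (h₁ : G.IsSkeleton len G₁ len₁)
    (h₂ : G.IsSkeleton len G₂ len₂) :
    ∃ (φ : E₁ ≃ E₂) (ψ : V₁ ≃ V₂), G₁.IsIso G₂ φ ψ ∧ ∀ e, len₂ (φ e) = len₁ e := by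
  obtain ⟨ψ₁, π₁, hi₁, hr₁, hs₁, hk₁, hc₁, hl₁⟩ := h₁
  obtain ⟨ψ₂, π₂, hi₂, hr₂, hs₂, hk₂, hc₂, hl₂⟩ := h₂
  -- Both projections have the same fibres, the classes of the relation generated by
  -- `MeetAtTwoValent`. Hence they differ by a bijection of their targets.
  have hk : ∀ e e', π₁ e = π₁ e' ↔ π₂ e = π₂ e' := fun e e' => (hk₁ e e').trans (hk₂ e e').symm
  let φ : E₁ ≃ E₂ :=
    { toFun := fun x => π₂ (Function.surjInv hs₁ x)
      invFun := fun x => π₁ (Function.surjInv hs₂ x)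
      left_inv := fun x =>
        ((hk _ _).2 (Function.surjInv_eq hs₂ _)).trans (Function.surjInv_eq hs₁ x)
      right_inv := fun x =>
        ((hk _ _).1 (Function.surjInv_eq hs₁ _)).trans (Function.surjInv_eq hs₂ x) }
  have hφ : ∀ e, φ (π₁ e) = π₂ e := fun e => (hk _ _).1 (Function.surjInv_eq hs₁ _)
  let ψ : V₁ ≃ V₂ := ((Equiv.ofInjective ψ₁ hi₁).trans (Equiv.setCongr (hr₁.trans hr₂.symm))).trans
    (Equiv.ofInjective ψ₂ hi₂).symm
  have hψ : ∀ v, ψ₂ (ψ v) = ψ₁ v := fun v =>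
    Equiv.apply_ofInjective_symm hi₂ (Equiv.setCongr (hr₁.trans hr₂.symm)
      (Equiv.ofInjective ψ₁ hi₁ v))
  have hfib : ∀ x, π₂ ⁻¹' {φ x} = π₁ ⁻¹' {x} := by
    intro x
    ext e
    simp only [Set.mem_preimage, Set.mem_singleton_iff]
    rw [← hφ, φ.injective.eq_iff]
  refine ⟨φ, ψ, fun x => ?_, fun x => ?_⟩
  -- `G₃` is `G₁` with vertices renamed by `ψ`, so that end counts are compared on a common vertex
  -- type.
  · let G₃ : Multigraph V₂ E₁ := ⟨fun e => (G₁.ends e).map ψ⟩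
    refine ends_eq_of_endCount (H := G₃) (f := x) fun w => ?_
    obtain ⟨v, rfl⟩ := ψ.surjective w
    rw [endCount_map (G := G₁) (H := G₃) (e := x) ψ.injective rfl, hc₂, hc₁, hfib, hψ]
  · rw [hl₂, hl₁, hfib]

theorem IsSkeleton.of_isIso {G : Multigraph V E} {len : E → ℝ} {G₁ : Multigraph V₁ E₁}
    {len₁ : E₁ → ℝ} {G₂ : Multigraph V₂ E₂} {len₂ : E₂ → ℝ} (h : G.IsSkeleton len G₁ len₁)
    {φ : E₁ ≃ E₂} {ψ : V₁ ≃ V₂} (hiso : G₁.IsIso G₂ φ ψ) (hlen : ∀ e, len₂ (φ e) = len₁ e) :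
    G.IsSkeleton len G₂ len₂ := by
  obtain ⟨ψ₁, π₁, hi₁, hr₁, hs₁, hk₁, hc₁, hl₁⟩ := h
  have hfib : ∀ x, (φ ∘ π₁) ⁻¹' {φ x} = π₁ ⁻¹' {x} := by
    intro x
    ext e
    simp
  refine ⟨ψ₁ ∘ ψ.symm, φ ∘ π₁, hi₁.comp ψ.symm.injective, ?_, φ.surjective.comp hs₁, ?_, ?_, ?_⟩
  · rw [← hr₁, Set.range_comp, ψ.symm.range_eq_univ, Set.image_univ]
  · intro e e'
    rw [← hk₁]
    exact φ.injective.eq_iff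
  · intro x v
    obtain ⟨x, rfl⟩ := φ.surjective x
    obtain ⟨v, rfl⟩ := ψ.surjective v
    rw [endCount_map ψ.injective (hiso x), hfib, hc₁]
    simp
  · intro x
    obtain ⟨x, rfl⟩ := φ.surjective x
    rw [hlen, hfib, hl₁]

/-- Pruning is stationary after one round, so only the terms `univ` and `S` occur in the
intersection. -/
theorem core_eq_of_prune {G : Multigraph V E} {S : Set E} (h₁ : G.prune Set.univ = S)
    (h₂ : G.prune S = S) : G.core = S := by
  have h : ∀ n : ℕ, G.prune^[n + 1] Set.univ = S := by
    intro n
    induction n with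
    | zero => exact h₁
    | succ n ih => rw [Function.iterate_succ_apply', ih, h₂]
  refine Set.Subset.antisymm ?_ ?_
  · exact (Set.iInter_subset _ 1).trans (h 0).subset
  · refine Set.subset_iInter fun n => ?_
    cases n with
    | zero => exact Set.subset_univ _
    | succ n => exact (h n).superset

section Embedding

variable {G : Multigraph V E} {H : Multigraph W F} {ι : V → W} {ε : E ≃ F}

/-- The vertex type of `curveGraph` is the whole plane, so a dual graph is compared with it along a
map of vertices that is only injective. Points off the image meet no edge and have valence zero. -/
theorem valence_image (hι : Function.Injective ι) (h : ∀ e, H.ends (ε e) = (G.ends e).map ι)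
    (S : Set E) (v : V) : H.valence (ε '' S) (ι v) = G.valence S v := by
  unfold valence
  rw [finsum_mem_image ε.injective.injOn]
  simp only [endCount_map hι (h _)]

theorem valence_eq_zero {S : Set F} {w : W} (h : ∀ f, w ∉ H.ends f) : H.valence S w = 0 := by
  unfold valence
  simp only [endCount_eq_zero (h _), finsum_zero]

theorem prune_image (hι : Function.Injective ι) (h : ∀ e, H.ends (ε e) = (G.ends e).map ι)
    (S : Set E) : H.prune (ε '' S) = ε '' G.prune S := by
  ext f
  obtain ⟨e, rfl⟩ := ε.surjective f
  simp only [prune, Set.mem_ofPred_eq, Set.mem_image, ε.injective.eq_iff, exists_eq_right, h]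
  refine and_congr_right fun _ => ⟨fun hv v hm => ?_, fun hv w hm => ?_⟩
  · rw [← valence_image hι h]
    exact hv _ (Sym2.mem_map.2 ⟨v, hm, rfl⟩)
  · obtain ⟨v, hm', rfl⟩ := Sym2.mem_map.1 hm
    rw [valence_image hι h]
    exact hv v hm'

theorem core_image (hι : Function.Injective ι) (h : ∀ e, H.ends (ε e) = (G.ends e).map ι) :
    H.core = ε '' G.core := by
  have hn : ∀ n : ℕ, H.prune^[n] Set.univ = ε '' (G.prune^[n] Set.univ) := by
    intro n
    induction n with
    | zero => simp
    | succ n ih => rw [Function.iterate_succ_apply', ih, prune_image hι h,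
        Function.iterate_succ_apply']
  unfold core
  rw [Set.image_iInter ε.bijective]
  exact Set.iInter_congr hn

/-- Skeletons do not change when isolated vertices are added and edges are renamed. -/
theorem IsSkeleton.of_embedding (hι : Function.Injective ι)
    (h : ∀ e, H.ends (ε e) = (G.ends e).map ι) {lenG : E → ℝ} {lenH : F → ℝ}
    (hlen : ∀ e, lenH (ε e) = lenG e) {G₁ : Multigraph V₁ E₁} {len₁ : E₁ → ℝ}
    (hs : G.IsSkeleton lenG G₁ len₁) : H.IsSkeleton lenH G₁ len₁ := by
  obtain ⟨ψ₁, π₁, hi₁, hr₁, hs₁, hk₁, hc₁, hl₁⟩ := hs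
  have hcore := core_image hι h
  let κ : G.core ≃ H.core := (ε.image G.core).trans (Equiv.setCongr hcore.symm)
  have hκ : ∀ e, (κ e : F) = ε e := fun e => rfl
  have hval : ∀ v, H.valence H.core (ι v) = G.valence G.core v := fun v => by
    rw [hcore, valence_image hι h]
  have hrange : ∀ w, w ∉ Set.range ι → ∀ f, w ∉ H.ends f := by
    intro w hw f hf
    obtain ⟨e, rfl⟩ := ε.surjective f
    rw [h] at hf
    obtain ⟨v, _, rfl⟩ := Sym2.mem_map.1 hf
    exact hw ⟨v, rfl⟩
  have hmeet : ∀ e e', H.MeetAtTwoValent (κ e) (κ e') ↔ G.MeetAtTwoValent e e' := by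
    intro e e'
    constructor
    · rintro ⟨w, hw, hw', h2⟩
      rw [hκ, h] at hw hw'
      obtain ⟨v, hv, rfl⟩ := Sym2.mem_map.1 hw
      obtain ⟨v', hv', hvv⟩ := Sym2.mem_map.1 hw'
      rw [hι hvv] at hv'
      exact ⟨v, hv, hv', by rw [← hval, h2]⟩
    · rintro ⟨v, hv, hv', h2⟩
      refine ⟨ι v, ?_, ?_, by rw [hval, h2]⟩
      · rw [hκ, h]; exact Sym2.mem_map.2 ⟨v, hv, rfl⟩
      · rw [hκ, h]; exact Sym2.mem_map.2 ⟨v, hv', rfl⟩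
  have hgen : ∀ e e', Relation.EqvGen H.MeetAtTwoValent (κ e) (κ e') ↔
      Relation.EqvGen G.MeetAtTwoValent e e' := by
    have aux : ∀ f f', Relation.EqvGen H.MeetAtTwoValent f f' →
        Relation.EqvGen G.MeetAtTwoValent (κ.symm f) (κ.symm f') := by
      intro f f' hff
      induction hff with
      | rel a b hab =>
        refine .rel _ _ ((hmeet _ _).1 ?_)
        rwa [κ.apply_symm_apply, κ.apply_symm_apply]
      | refl a => exact .refl _
      | symm a b _ ih => exact .symm _ _ ih
      | trans a b c _ _ ih ih' => exact .trans _ _ _ ih ih'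
    intro e e'
    constructor
    · intro hee
      simpa using aux _ _ hee
    · intro hee
      induction hee with
      | rel a b hab => exact .rel _ _ ((hmeet _ _).2 hab)
      | refl a => exact .refl _
      | symm a b _ ih => exact .symm _ _ ih
      | trans a b c _ _ ih ih' => exact .trans _ _ _ ih ih'
  have hsum : ∀ {M : Type} [AddCommMonoid M] (a : F → M) (x : E₁),
      ∑ᶠ f ∈ (π₁ ∘ κ.symm) ⁻¹' {x}, a (f : H.core) = ∑ᶠ e ∈ π₁ ⁻¹' {x}, a (ε (e : G.core)) := by
    intro M _ a x
    rw [← finsum_comp_equiv κ]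
    refine finsum_congr fun e => ?_
    simp [hκ]
  refine ⟨ι ∘ ψ₁, π₁ ∘ κ.symm, hι.comp hi₁, ?_, hs₁.comp κ.symm.surjective, ?_, ?_, ?_⟩
  · ext w
    by_cases hw : w ∈ Set.range ι
    · obtain ⟨v, rfl⟩ := hw
      have := Set.ext_iff.1 hr₁ v
      simp only [Set.mem_range, Set.mem_ofPred_eq, Function.comp_apply, hι.eq_iff, hval] at this ⊢
      exact this
    · simp only [Set.mem_ofPred_eq, valence_eq_zero (hrange w hw)]
      refine iff_of_false ?_ (by norm_num)
      rintro ⟨v, rfl⟩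
      exact hw ⟨_, rfl⟩
  · intro f f'
    obtain ⟨e, rfl⟩ := κ.surjective f
    obtain ⟨e', rfl⟩ := κ.surjective f'
    rw [hgen, ← hk₁]
    simp
  · intro x v
    rw [hsum (fun f => H.endCount f _), hc₁]
    simp only [Function.comp_apply, endCount_map hι (h _)]
  · intro x
    rw [hsum, hl₁]
    simp only [hlen]

end Embedding

end Multigraph

/-! ### The graph dual to the triangulation and its skeleton -/

/-- The triangles: `t j`, `m j` and `b j` are the upper, middle and lower triangle with index `j`. -/
inductive DualVertex (g : ℕ) : Type
  | t : Fin (g + 1) → DualVertex g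
  | m : Fin (g + 1) → DualVertex g
  | b : Fin (g + 1) → DualVertex g

/-- The interior edges of the triangulation. -/
inductive DualEdge (g : ℕ) : Type
  | tt : Fin g → DualEdge g
  | tm : Fin (g + 1) → DualEdge g
  | mb : Fin (g + 1) → DualEdge g
  | bm : Fin g → DualEdge g
  deriving DecidableEq

/-- The dual graph of the triangulation. -/
def dualGraph (g : ℕ) : Multigraph (DualVertex g) (DualEdge g) where
  ends
    | .tt j => s(.t j.castSucc, .t j.succ)
    | .tm j => s(.t j, .m j)
    | .mb j => s(.m j, .b j)
    | .bm j => s(.b j.castSucc, .m j.succ)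

/-- Edges of the dual graph as a sum type. -/
def dualEdgeEquiv (g : ℕ) :
    ((Fin g ⊕ Fin (g + 1)) ⊕ (Fin (g + 1) ⊕ Fin g)) ≃ DualEdge g where
  toFun
    | .inl (.inl j) => .tt j
    | .inl (.inr j) => .tm j
    | .inr (.inl j) => .mb j
    | .inr (.inr j) => .bm j
  invFun
    | .tt j => .inl (.inl j)
    | .tm j => .inl (.inr j)
    | .mb j => .inr (.inl j)
    | .bm j => .inr (.inr j)
  left_inv := by rintro ((j | j) | (j | j)) <;> rfl
  right_inv := by rintro (j | j | j | j) <;> rfl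

theorem finsum_dualEdge {g : ℕ} {M : Type*} [AddCommMonoid M] (f : DualEdge g → M) :
    ∑ᶠ e, f e = (∑ j, f (.tt j) + ∑ j, f (.tm j)) + (∑ j, f (.mb j) + ∑ j, f (.bm j)) := by
  rw [← finsum_comp_equiv (dualEdgeEquiv g), finsum_eq_sum_of_fintype, Fintype.sum_sum_type,
    Fintype.sum_sum_type, Fintype.sum_sum_type]
  rfl

theorem sum_fin_eq (n i : ℕ) :
    ∑ j : Fin n, (if (j : ℕ) = i then 1 else 0) = if i < n then 1 else 0 := by
  rw [Fin.sum_univ_eq_sum_range (fun j => if j = i then 1 else 0), Finset.sum_ite_eq']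
  simp

theorem sum_fin_succ_eq (n i : ℕ) :
    ∑ j : Fin n, (if (j : ℕ) + 1 = i then 1 else 0) = if 0 < i ∧ i ≤ n then 1 else 0 := by
  cases i with
  | zero => simp
  | succ i => simp only [Nat.add_right_cancel_iff, sum_fin_eq, Nat.succ_pos, true_and,
      Nat.succ_le_iff]

section EndCount

variable {g : ℕ}

theorem endCount_tt_t (j : Fin g) (i : Fin (g + 1)) : (dualGraph g).endCount (.tt j) (.t i) =
    (if (j : ℕ) = i then 1 else 0) + (if (j : ℕ) + 1 = i then 1 else 0) := by
  rw [Multigraph.endCount_eq (G := dualGraph g) (e := .tt j) rfl]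
  simp [Fin.ext_iff]

theorem endCount_tt_m (j : Fin g) (i : Fin (g + 1)) :
    (dualGraph g).endCount (.tt j) (.m i) = 0 := by
  rw [Multigraph.endCount_eq (G := dualGraph g) (e := .tt j) rfl]
  simp

theorem endCount_tt_b (j : Fin g) (i : Fin (g + 1)) :
    (dualGraph g).endCount (.tt j) (.b i) = 0 := by
  rw [Multigraph.endCount_eq (G := dualGraph g) (e := .tt j) rfl]
  simp

theorem endCount_tm_t (j i : Fin (g + 1)) : (dualGraph g).endCount (.tm j) (.t i) =
    (if (j : ℕ) = i then 1 else 0) := by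
  rw [Multigraph.endCount_eq (G := dualGraph g) (e := .tm j) rfl]
  simp [Fin.ext_iff]

theorem endCount_tm_m (j i : Fin (g + 1)) : (dualGraph g).endCount (.tm j) (.m i) =
    (if (j : ℕ) = i then 1 else 0) := by
  rw [Multigraph.endCount_eq (G := dualGraph g) (e := .tm j) rfl]
  simp [Fin.ext_iff]

theorem endCount_tm_b (j i : Fin (g + 1)) : (dualGraph g).endCount (.tm j) (.b i) = 0 := by
  rw [Multigraph.endCount_eq (G := dualGraph g) (e := .tm j) rfl]
  simp

theorem endCount_mb_t (j i : Fin (g + 1)) : (dualGraph g).endCount (.mb j) (.t i) = 0 := by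
  rw [Multigraph.endCount_eq (G := dualGraph g) (e := .mb j) rfl]
  simp

theorem endCount_mb_m (j i : Fin (g + 1)) : (dualGraph g).endCount (.mb j) (.m i) =
    (if (j : ℕ) = i then 1 else 0) := by
  rw [Multigraph.endCount_eq (G := dualGraph g) (e := .mb j) rfl]
  simp [Fin.ext_iff]

theorem endCount_mb_b (j i : Fin (g + 1)) : (dualGraph g).endCount (.mb j) (.b i) =
    (if (j : ℕ) = i then 1 else 0) := by
  rw [Multigraph.endCount_eq (G := dualGraph g) (e := .mb j) rfl]
  simp [Fin.ext_iff]

theorem endCount_bm_t (j : Fin g) (i : Fin (g + 1)) :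
    (dualGraph g).endCount (.bm j) (.t i) = 0 := by
  rw [Multigraph.endCount_eq (G := dualGraph g) (e := .bm j) rfl]
  simp

theorem endCount_bm_m (j : Fin g) (i : Fin (g + 1)) : (dualGraph g).endCount (.bm j) (.m i) =
    (if (j : ℕ) + 1 = i then 1 else 0) := by
  rw [Multigraph.endCount_eq (G := dualGraph g) (e := .bm j) rfl]
  simp [Fin.ext_iff]

theorem endCount_bm_b (j : Fin g) (i : Fin (g + 1)) : (dualGraph g).endCount (.bm j) (.b i) =
    (if (j : ℕ) = i then 1 else 0) := by
  rw [Multigraph.endCount_eq (G := dualGraph g) (e := .bm j) rfl]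
  simp [Fin.ext_iff]

theorem valence_univ_t (i : Fin (g + 1)) : (dualGraph g).valence Set.univ (.t i) =
    (if (i : ℕ) < g then 1 else 0) + (if 0 < (i : ℕ) then 1 else 0) + 1 := by
  unfold Multigraph.valence
  simp only [Set.mem_univ, finsum_true, finsum_dualEdge, endCount_tt_t, endCount_tm_t,
    endCount_mb_t, endCount_bm_t, Finset.sum_add_distrib, sum_fin_eq, sum_fin_succ_eq,
    Finset.sum_const_zero]
  split_ifs <;> omega

theorem valence_univ_m (i : Fin (g + 1)) : (dualGraph g).valence Set.univ (.m i) =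
    2 + (if 0 < (i : ℕ) then 1 else 0) := by
  unfold Multigraph.valence
  simp only [Set.mem_univ, finsum_true, finsum_dualEdge, endCount_tt_m, endCount_tm_m,
    endCount_mb_m, endCount_bm_m, sum_fin_eq, sum_fin_succ_eq,
    Finset.sum_const_zero]
  split_ifs <;> omega

theorem valence_univ_b (i : Fin (g + 1)) : (dualGraph g).valence Set.univ (.b i) =
    1 + (if (i : ℕ) < g then 1 else 0) := by
  unfold Multigraph.valence
  simp only [Set.mem_univ, finsum_true, finsum_dualEdge, endCount_tt_b, endCount_tm_b,
    endCount_mb_b, endCount_bm_b, sum_fin_eq, Finset.sum_const_zero]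
  split_ifs <;> omega

/-- All edges but the pendant one. -/
def coreEdges (g : ℕ) : Set (DualEdge g) := {e | e ≠ .mb (Fin.last g)}

/-- Valences in the core are obtained from those in the full graph by subtracting the contribution
of the pendant edge. -/
theorem valence_coreEdges_add (v : DualVertex g) : (dualGraph g).valence (coreEdges g) v +
    (dualGraph g).endCount (.mb (Fin.last g)) v = (dualGraph g).valence Set.univ v := by
  have : Finite (DualEdge g) := Finite.of_equiv _ (dualEdgeEquiv g)
  have h : (Set.univ : Set (DualEdge g)) = insert (.mb (Fin.last g)) (coreEdges g) := by
    ext e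
    simp [coreEdges, em]
  unfold Multigraph.valence
  rw [h, finsum_mem_insert _ (by simp [coreEdges]) (Set.toFinite _), add_comm]

theorem valence_coreEdges_t (i : Fin (g + 1)) : (dualGraph g).valence (coreEdges g) (.t i) =
    (if (i : ℕ) < g then 1 else 0) + (if 0 < (i : ℕ) then 1 else 0) + 1 := by
  have := valence_coreEdges_add (.t i)
  rwa [endCount_mb_t, valence_univ_t] at this

theorem valence_coreEdges_m (i : Fin (g + 1)) : (dualGraph g).valence (coreEdges g) (.m i) =
    (if (i : ℕ) < g then 1 else 0) + (if 0 < (i : ℕ) then 1 else 0) + 1 := by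
  have := valence_coreEdges_add (.m i)
  have hi := i.2
  rw [endCount_mb_m, valence_univ_m] at this
  simp only [Fin.val_last] at this
  split_ifs at * <;> omega

theorem valence_coreEdges_b (i : Fin (g + 1)) : (dualGraph g).valence (coreEdges g) (.b i) =
    if (i : ℕ) < g then 2 else 0 := by
  have := valence_coreEdges_add (.b i)
  have hi := i.2
  rw [endCount_mb_b, valence_univ_b] at this
  simp only [Fin.val_last] at this
  split_ifs at * <;> omega

end EndCount

/-- The only 1-valent vertex is the last lower triangle, which has two edges on the boundary of the
polygon. Once its edge is gone, every vertex has valence 0, 2 or 3. -/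
theorem core_dualGraph {g : ℕ} (hg : 2 ≤ g) : (dualGraph g).core = coreEdges g := by
  apply Multigraph.core_eq_of_prune
  · ext e
    rcases e with j | j | j | j <;>
    · have := j.2
      simp only [Multigraph.prune, Set.mem_univ, true_and, Set.mem_ofPred_eq, dualGraph,
        Sym2.mem_iff, forall_eq_or_imp, forall_eq, coreEdges]
      change (dualGraph g).valence _ _ ≠ 1 ∧ (dualGraph g).valence _ _ ≠ 1 ↔ _
      simp only [valence_univ_t, valence_univ_m, valence_univ_b, ne_eq, reduceCtorEq,
        not_false_eq_true, iff_true, DualEdge.mb.injEq, Fin.ext_iff, Fin.val_last, Fin.val_castSucc,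
        Fin.val_succ]
      split_ifs <;> omega
  · ext e
    rcases e with j | j | j | j <;>
    · have := j.2
      simp only [Multigraph.prune, Set.mem_ofPred_eq, dualGraph,
        Sym2.mem_iff, forall_eq_or_imp, forall_eq, coreEdges]
      change _ ∧ (dualGraph g).valence (coreEdges g) _ ≠ 1 ∧
        (dualGraph g).valence (coreEdges g) _ ≠ 1 ↔ _
      simp only [valence_coreEdges_t, valence_coreEdges_m, valence_coreEdges_b, ne_eq, reduceCtorEq,
        not_false_eq_true, iff_true, true_and, DualEdge.mb.injEq, Fin.ext_iff, Fin.val_last,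
        Fin.val_castSucc, Fin.val_succ]
      split_ifs <;> omega

/-- The edge of the chain of loops into which an edge of the dual graph is concatenated. -/
def concatEdge {g : ℕ} (hg : 2 ≤ g) : DualEdge g → ChainEdge g
  | .tt j => if h0 : (j : ℕ) = 0 then .first else if h1 : (j : ℕ) + 1 = g then .last
      else .u ⟨j - 1, by omega⟩
  | .tm j => if h0 : (j : ℕ) = 0 then .first else if h1 : (j : ℕ) = g then .last
      else .h ⟨j - 1, by omega⟩
  -- The inequality also covers `j = g`, the pendant edge. It is not in the core, and its value here
  -- is irrelevant.
  | .mb j => if h0 : (j : ℕ) = 0 then .first else if h1 : g ≤ (j : ℕ) + 1 then .last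
      else .w ⟨j - 1, by omega⟩
  | .bm j => if h0 : (j : ℕ) = 0 then .first else if h1 : (j : ℕ) + 1 = g then .last
      else .w ⟨j - 1, by omega⟩

/-- The trivalent vertex of the core that is a given vertex of the chain of loops. -/
def chainVertex {g : ℕ} : Fin (g - 1) × Bool → DualVertex g
  | (j, true) => .t ⟨j + 1, by omega⟩
  | (j, false) => .m ⟨j + 1, by omega⟩

/-- The edges of the dual graph that are concatenated to a given edge of the chain of loops. -/
def concatFiber {g : ℕ} (hg : 2 ≤ g) : ChainEdge g → Finset (DualEdge g)
  | .first => {.tt ⟨0, by omega⟩, .tm ⟨0, by omega⟩, .mb ⟨0, by omega⟩, .bm ⟨0, by omega⟩}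
  | .last => {.tt ⟨g - 1, by omega⟩, .tm ⟨g, by omega⟩, .bm ⟨g - 1, by omega⟩,
      .mb ⟨g - 1, by omega⟩}
  | .h j => {.tm ⟨j + 1, by omega⟩}
  | .u k => {.tt ⟨k + 1, by omega⟩}
  | .w k => {.mb ⟨k + 1, by omega⟩, .bm ⟨k + 1, by omega⟩}

section

variable {g : ℕ} (hg : 2 ≤ g)

/-- The fibres are listed explicitly in order to turn the sums in `IsSkeleton` into short finite
sums. -/
theorem mem_concatFiber (x : ChainEdge g) (e : DualEdge g) :
    e ∈ concatFiber hg x ↔ e ∈ coreEdges g ∧ concatEdge hg e = x := by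
  rcases e with ⟨j, hj⟩ | ⟨j, hj⟩ | ⟨j, hj⟩ | ⟨j, hj⟩ <;>
  rcases x with _ | _ | ⟨k, hk⟩ | ⟨k, hk⟩ | ⟨k, hk⟩ <;>
  simp only [concatFiber, concatEdge, coreEdges, Set.mem_ofPred_eq, Finset.mem_insert,
    Finset.mem_singleton, DualEdge.tt.injEq, DualEdge.tm.injEq, DualEdge.mb.injEq,
    DualEdge.bm.injEq, Fin.ext_iff, reduceCtorEq, or_false, false_or, ne_eq, not_false_eq_true,
    true_and, Fin.val_last, false_iff] <;>
  split_ifs <;>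
  first
  | exact not_false
  | exact fun h => h.2
  | omega
  | (simp only [iff_true, iff_false, and_false, and_true]; done)
  | (simp only [iff_true, iff_false, and_false, and_true]; omega)
  | (simp only [ChainEdge.h.injEq, ChainEdge.u.injEq, ChainEdge.w.injEq, Fin.ext_iff]; omega)

theorem finsum_concat {M : Type*} [AddCommMonoid M] (a : DualEdge g → M) (x : ChainEdge g)
    {S : Set (DualEdge g)} (hS : S = coreEdges g) :
    ∑ᶠ e ∈ (fun e : S => concatEdge hg e) ⁻¹' {x}, a (e : S) = ∑ e ∈ concatFiber hg x, a e := by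
  subst hS
  rw [← finsum_mem_image (f := a) (g := Subtype.val) Subtype.val_injective.injOn,
    ← finsum_mem_coe_finset]
  refine finsum_mem_congr (Set.ext fun e => ?_) fun _ _ => rfl
  simp only [Set.mem_image, Set.mem_preimage, Set.mem_singleton_iff, Subtype.exists,
    exists_and_left, exists_prop, exists_eq_right_right, Finset.mem_coe, mem_concatFiber]
  exact and_comm

theorem chainVertex_injective : Function.Injective (chainVertex (g := g)) := by
  rintro ⟨⟨j, hj⟩, _ | _⟩ ⟨⟨k, hk⟩, _ | _⟩ h <;> simp [chainVertex] at h ⊢ <;> exact h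

theorem range_chainVertex :
    Set.range (chainVertex (g := g)) = {v | 3 ≤ (dualGraph g).valence (coreEdges g) v} := by
  ext v
  constructor
  · rintro ⟨⟨⟨j, hj⟩, _ | _⟩, rfl⟩ <;>
      simp only [chainVertex, Set.mem_ofPred_eq, valence_coreEdges_t, valence_coreEdges_m] <;>
      split_ifs <;> omega
  · rcases v with ⟨j, hj⟩ | ⟨j, hj⟩ | ⟨j, hj⟩ <;>
      simp only [Set.mem_ofPred_eq, valence_coreEdges_t, valence_coreEdges_m,
        valence_coreEdges_b] <;> intro h
    · have : 0 < j ∧ j < g := by split_ifs at h <;> omega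
      refine ⟨(⟨j - 1, by omega⟩, true), ?_⟩
      simp only [chainVertex, DualVertex.t.injEq, Fin.ext_iff]
      omega
    · have : 0 < j ∧ j < g := by split_ifs at h <;> omega
      refine ⟨(⟨j - 1, by omega⟩, false), ?_⟩
      simp only [chainVertex, DualVertex.m.injEq, Fin.ext_iff]
      omega
    · split_ifs at h <;> omega

theorem endCount_chainGraph (x : ChainEdge g) (v : Fin (g - 1) × Bool) :
    (chainGraph g hg).endCount x v =
      ∑ e ∈ concatFiber hg x, (dualGraph g).endCount e (chainVertex v) := by
  obtain ⟨⟨i, hi⟩, _ | _⟩ := v <;> rcases x with _ | _ | ⟨k, hk⟩ | ⟨k, hk⟩ | ⟨k, hk⟩ <;>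
  · rw [Multigraph.endCount_eq (G := chainGraph g hg) rfl]
    simp only [concatFiber, Finset.mem_insert, Finset.mem_singleton, reduceCtorEq, or_self,
      not_false_eq_true, Finset.sum_insert, Finset.sum_singleton, chainVertex,
      endCount_tt_t, endCount_tt_m, endCount_tm_t, endCount_tm_m, endCount_mb_t,
      endCount_mb_m, endCount_bm_t, endCount_bm_m, Prod.mk.injEq, Fin.ext_iff, leftIdx, rightIdx,
      and_true, and_false, if_false, add_zero, zero_add]
    try (split_ifs <;> omega)

/-- The 2-valent vertices of the core are `t 0`, `m 0`, `t g`, `m g` and the `b j` with `j < g`. At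
each of them the two incident core edges go to the same chain edge. -/
theorem concatEdge_eq_of_meet {S : Set (DualEdge g)} (hS : S = coreEdges g) {e e' : DualEdge g}
    {v : DualVertex g} (hv : v ∈ (dualGraph g).ends e) (hv' : v ∈ (dualGraph g).ends e')
    (he : e ∈ S) (he' : e' ∈ S)
    (h2 : (dualGraph g).valence S v = 2) : concatEdge hg e = concatEdge hg e' := by
  subst hS
  rcases v with ⟨i, hi⟩ | ⟨i, hi⟩ | ⟨i, hi⟩ <;>
  rcases e with ⟨j, hj⟩ | ⟨j, hj⟩ | ⟨j, hj⟩ | ⟨j, hj⟩ <;>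
  rcases e' with ⟨k, hk⟩ | ⟨k, hk⟩ | ⟨k, hk⟩ | ⟨k, hk⟩ <;>
  simp only [dualGraph, Sym2.mem_iff, reduceCtorEq, DualVertex.t.injEq, DualVertex.m.injEq,
    DualVertex.b.injEq, Fin.ext_iff, Fin.val_castSucc, Fin.val_succ, or_false, false_or,
    or_self] at hv hv' <;>
  simp only [coreEdges, Set.mem_ofPred_eq, ne_eq, DualEdge.mb.injEq, Fin.ext_iff, Fin.val_last,
    reduceCtorEq, not_false_eq_true] at he he' <;>
  simp only [valence_coreEdges_t, valence_coreEdges_m, valence_coreEdges_b] at h2 <;>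
  split_ifs at h2 <;>
  simp only [concatEdge] <;>
  split_ifs <;>
  first
  | rfl
  | omega
  | (simp only [ChainEdge.w.injEq, Fin.ext_iff]; omega)

theorem eqvGen_of_meet (hg : 2 ≤ g) {e e' : DualEdge g} (he : e ∈ (dualGraph g).core)
    (he' : e' ∈ (dualGraph g).core) (v : DualVertex g) (hv : v ∈ (dualGraph g).ends e)
    (hv' : v ∈ (dualGraph g).ends e') (h2 : (dualGraph g).valence (coreEdges g) v = 2) :
    Relation.EqvGen (dualGraph g).MeetAtTwoValent ⟨e, he⟩ ⟨e', he'⟩ :=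
  .rel _ _ ⟨v, hv, hv', by rwa [core_dualGraph hg]⟩

theorem eqvGen_of_concatEdge_eq {x : ChainEdge g} {e e' : DualEdge g}
    (he : e ∈ (dualGraph g).core) (he' : e' ∈ (dualGraph g).core)
    (h : concatEdge hg e = x) (h' : concatEdge hg e' = x) :
    Relation.EqvGen (dualGraph g).MeetAtTwoValent ⟨e, he⟩ ⟨e', he'⟩ := by
  -- Each fibre is a path through 2-valent vertices, so its edges are joined to the first edge of
  -- the path. For the two outer cycles the path passes through the vertices `t 0`, `m 0`, `b 0`,
  -- respectively `t g`, `m g`, `b (g-1)`.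
  suffices H : ∃ a : (dualGraph g).core, ∀ e (he : e ∈ (dualGraph g).core),
      e ∈ concatFiber hg x → Relation.EqvGen (dualGraph g).MeetAtTwoValent a ⟨e, he⟩ by
    obtain ⟨a, ha⟩ := H
    have hc := core_dualGraph hg
    refine .trans _ a _ (.symm _ _ (ha e he ?_)) (ha e' he' ?_) <;> rw [mem_concatFiber]
    · exact ⟨hc ▸ he, h⟩
    · exact ⟨hc ▸ he', h'⟩
  have hcore : ∀ e, e ≠ .mb (Fin.last g) → e ∈ (dualGraph g).core := fun e he => by
    rw [core_dualGraph hg]; exact he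
  rcases x with _ | _ | k | k | k
  · have h₁ := eqvGen_of_meet hg (e := .tt ⟨0, by omega⟩) (e' := .tm ⟨0, by omega⟩)
      (hcore _ (by simp)) (hcore _ (by simp)) (.t ⟨0, by omega⟩) (by simp [dualGraph])
      (by simp [dualGraph]) (by rw [valence_coreEdges_t]; simp; omega)
    have h₂ := eqvGen_of_meet hg (e := .tm ⟨0, by omega⟩) (e' := .mb ⟨0, by omega⟩)
      (hcore _ (by simp)) (hcore _ (by simp [Fin.ext_iff]; omega)) (.m ⟨0, by omega⟩)
      (by simp [dualGraph])
      (by simp [dualGraph]) (by rw [valence_coreEdges_m]; simp; omega)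
    have h₃ := eqvGen_of_meet hg (e := .mb ⟨0, by omega⟩) (e' := .bm ⟨0, by omega⟩)
      (hcore _ (by simp [Fin.ext_iff]; omega)) (hcore _ (by simp)) (.b ⟨0, by omega⟩)
      (by simp [dualGraph])
      (by simp [dualGraph]) (by rw [valence_coreEdges_b]; simp; omega)
    refine ⟨⟨.tt ⟨0, by omega⟩, hcore _ (by simp)⟩, fun e he hm => ?_⟩
    simp only [concatFiber, Finset.mem_insert, Finset.mem_singleton] at hm
    rcases hm with rfl | rfl | rfl | rfl
    · exact .refl _
    · exact h₁
    · exact .trans _ _ _ h₁ h₂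
    · exact .trans _ _ _ (.trans _ _ _ h₁ h₂) h₃
  · have h₁ := eqvGen_of_meet hg (e := .tt ⟨g - 1, by omega⟩) (e' := .tm ⟨g, by omega⟩)
      (hcore _ (by simp)) (hcore _ (by simp)) (.t ⟨g, by omega⟩)
      (by simp [dualGraph, Fin.ext_iff]; omega)
      (by simp [dualGraph]) (by rw [valence_coreEdges_t]; simp; omega)
    have h₂ := eqvGen_of_meet hg (e := .tm ⟨g, by omega⟩) (e' := .bm ⟨g - 1, by omega⟩)
      (hcore _ (by simp)) (hcore _ (by simp)) (.m ⟨g, by omega⟩)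
      (by simp [dualGraph])
      (by simp [dualGraph, Fin.ext_iff]; omega)
      (by rw [valence_coreEdges_m]; simp; omega)
    have h₃ := eqvGen_of_meet hg (e := .bm ⟨g - 1, by omega⟩) (e' := .mb ⟨g - 1, by omega⟩)
      (hcore _ (by simp)) (hcore _ (by simp [Fin.ext_iff]; omega)) (.b ⟨g - 1, by omega⟩)
      (by simp [dualGraph])
      (by simp [dualGraph]) (by rw [valence_coreEdges_b]; simp; omega)
    refine ⟨⟨.tt ⟨g - 1, by omega⟩, hcore _ (by simp)⟩, fun e he hm => ?_⟩
    simp only [concatFiber, Finset.mem_insert, Finset.mem_singleton] at hm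
    rcases hm with rfl | rfl | rfl | rfl
    · exact .refl _
    · exact h₁
    · exact .trans _ _ _ h₁ h₂
    · exact .trans _ _ _ (.trans _ _ _ h₁ h₂) h₃
  · refine ⟨⟨.tm ⟨k + 1, by omega⟩, hcore _ (by simp)⟩, fun e he hm => ?_⟩
    simp only [concatFiber, Finset.mem_singleton] at hm
    subst hm
    exact .refl _
  · refine ⟨⟨.tt ⟨k + 1, by omega⟩, hcore _ (by simp)⟩, fun e he hm => ?_⟩
    simp only [concatFiber, Finset.mem_singleton] at hm
    subst hm
    exact .refl _
  · have h₁ := eqvGen_of_meet hg (e := .bm ⟨k + 1, by omega⟩) (e' := .mb ⟨k + 1, by omega⟩)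
      (hcore _ (by simp)) (hcore _ (by simp [Fin.ext_iff]; omega)) (.b ⟨k + 1, by omega⟩)
      (by simp [dualGraph])
      (by simp [dualGraph]) (by rw [valence_coreEdges_b]; simp; omega)
    refine ⟨⟨.bm ⟨k + 1, by omega⟩, hcore _ (by simp)⟩, fun e he hm => ?_⟩
    simp only [concatFiber, Finset.mem_insert, Finset.mem_singleton] at hm
    rcases hm with rfl | rfl
    · exact h₁
    · exact .refl _

theorem concatFiber_nonempty (x : ChainEdge g) : (concatFiber hg x).Nonempty := by
  rcases x with _ | _ | k | k | k <;> simp [concatFiber]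

/-- The skeleton of the dual graph is the chain of loops. -/
theorem isSkeleton_dualGraph (len : DualEdge g → ℝ) :
    (dualGraph g).IsSkeleton len (chainGraph g hg) fun x => ∑ e ∈ concatFiber hg x, len e := by
  have hc := core_dualGraph hg
  refine ⟨chainVertex, fun e => concatEdge hg e, chainVertex_injective, ?_, ?_, ?_, ?_, ?_⟩
  · rw [hc, range_chainVertex]
  · intro x
    obtain ⟨e, he⟩ := concatFiber_nonempty hg x
    rw [mem_concatFiber, ← hc] at he
    exact ⟨⟨e, he.1⟩, he.2⟩
  · intro e e'
    constructor
    · intro h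
      exact eqvGen_of_concatEdge_eq hg e.2 e'.2 h rfl
    · intro h
      induction h with
      | rel a b hab =>
        obtain ⟨v, hv, hv', h2⟩ := hab
        exact concatEdge_eq_of_meet hg hc hv hv' a.2 b.2 h2
      | refl a => rfl
      | symm a b _ ih => exact ih.symm
      | trans a b c _ _ ih ih' => exact ih.trans ih'
  · intro x v
    rw [finsum_concat hg (fun e => (dualGraph g).endCount e (chainVertex v)) x hc,
      endCount_chainGraph]
  · intro x
    rw [finsum_concat hg len x hc]

end

/-! ### Lattice points of the polygon -/

/-- The last inequality is the edge from `(0,2)` to `(g+1,1)`. It bounds the heights by 2 and leaves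
`(0,2)` as the only lattice point at height 2. -/
theorem polygonH_subset (g : ℕ) : polygonH g ⊆
    {p | 0 ≤ p.1 ∧ 0 ≤ p.2 ∧ p.1 ≤ g + 1 ∧ p.1 + (g + 1) * p.2 ≤ 2 * (g + 1)} := by
  have hg : (0 : ℝ) ≤ g := Nat.cast_nonneg g
  refine convexHull_min ?_ ?_
  · rintro p (rfl | rfl | rfl | rfl) <;> simp <;> (try constructor) <;> nlinarith
  · rintro ⟨x, y⟩ ⟨h1, h2, h3, h4⟩ ⟨x', y'⟩ ⟨h1', h2', h3', h4'⟩ a b ha hb hab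
    simp only [Set.mem_ofPred_eq, Prod.smul_mk, Prod.mk_add_mk, smul_eq_mul] at *
    have e : b = 1 - a := by linarith
    refine ⟨by positivity, by positivity, ?_, ?_⟩
    · nlinarith [mul_le_mul_of_nonneg_left h3 ha, mul_le_mul_of_nonneg_left h3' hb]
    · nlinarith [mul_le_mul_of_nonneg_left h4 ha, mul_le_mul_of_nonneg_left h4' hb]

theorem mem_latticePoints_zero {g j : ℕ} (hj : j ≤ g + 1) :
    ((j : ℤ), (0 : ℤ)) ∈ latticePoints (polygonH g) := by
  have h := convex_convexHull ℝ
    ({(0, 0), (0, 2), ((g : ℝ) + 1, 0), ((g : ℝ) + 1, 1)} : Set (ℝ × ℝ))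
  have hj' : (j : ℝ) ≤ g + 1 := by exact_mod_cast hj
  have hg : (0 : ℝ) < g + 1 := by positivity
  have := h (subset_convexHull ℝ _ (show ((0 : ℝ), (0 : ℝ)) ∈ _ by simp))
    (subset_convexHull ℝ _ (show ((g : ℝ) + 1, (0 : ℝ)) ∈ _ by simp))
    (a := 1 - j / (g + 1)) (b := j / (g + 1)) (by rw [sub_nonneg, div_le_one hg]; exact hj')
    (by positivity) (by ring)
  change toPlane _ ∈ convexHull ℝ _
  convert this using 1
  simp only [toPlane, Prod.smul_mk, smul_eq_mul, Prod.mk_add_mk]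
  ext <;> simp
  field_simp

theorem mem_latticePoints_one {g j : ℕ} (hj : j ≤ g + 1) :
    ((j : ℤ), (1 : ℤ)) ∈ latticePoints (polygonH g) := by
  have h := convex_convexHull ℝ
    ({(0, 0), (0, 2), ((g : ℝ) + 1, 0), ((g : ℝ) + 1, 1)} : Set (ℝ × ℝ))
  have hj' : (j : ℝ) ≤ g + 1 := by exact_mod_cast hj
  have hg : (0 : ℝ) < g + 1 := by positivity
  -- The left end `(0,1)` of the middle row is not a vertex of the polygon; it is the midpoint of
  -- `(0,0)` and `(0,2)`.
  have h0 := h (subset_convexHull ℝ _ (show ((0 : ℝ), (0 : ℝ)) ∈ _ by simp))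
    (subset_convexHull ℝ _ (show ((0 : ℝ), (2 : ℝ)) ∈ _ by simp))
    (a := 1 / 2) (b := 1 / 2) (by norm_num) (by norm_num) (by norm_num)
  have := h h0
    (subset_convexHull ℝ _ (show ((g : ℝ) + 1, (1 : ℝ)) ∈ _ by simp))
    (a := 1 - j / (g + 1)) (b := j / (g + 1)) (by rw [sub_nonneg, div_le_one hg]; exact hj')
    (by positivity) (by ring)
  change toPlane _ ∈ convexHull ℝ _
  convert this using 1
  simp only [toPlane, Prod.smul_mk, smul_eq_mul, Prod.mk_add_mk]
  ext <;> simp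
  field_simp

theorem mem_latticePoints_two (g : ℕ) : ((0 : ℤ), (2 : ℤ)) ∈ latticePoints (polygonH g) := by
  have := subset_convexHull ℝ ({(0, 0), (0, 2), ((g : ℝ) + 1, 0), ((g : ℝ) + 1, 1)} : Set (ℝ × ℝ))
    (show ((0 : ℝ), (2 : ℝ)) ∈ _ by simp)
  simpa [latticePoints, toPlane, polygonH] using this

theorem mem_latticePoints_iff {g : ℕ} {a : ℤ × ℤ} : a ∈ latticePoints (polygonH g) ↔
    a = (0, 2) ∨ ∃ j : ℕ, j ≤ g + 1 ∧ (a = (↑j, 1) ∨ a = (↑j, 0)) := by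
  constructor
  · intro h
    obtain ⟨x, y⟩ := a
    obtain ⟨h1, h2, h3, h4⟩ := polygonH_subset g h
    simp only [toPlane] at h1 h2 h3 h4
    have h1' : 0 ≤ x := by exact_mod_cast h1
    have h2' : 0 ≤ y := by exact_mod_cast h2
    have h3' : x ≤ g + 1 := by exact_mod_cast h3
    have h4' : x + (g + 1) * y ≤ 2 * (g + 1) := by exact_mod_cast h4
    have hy : y ≤ 2 := by
      by_contra hy
      have : (3 : ℤ) ≤ y := by omega
      nlinarith
    lift x to ℕ using h1'
    have hy' : y = 0 ∨ y = 1 ∨ y = 2 := by omega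
    rcases hy' with rfl | rfl | rfl
    · exact Or.inr ⟨x, by omega, Or.inr rfl⟩
    · exact Or.inr ⟨x, by omega, Or.inl rfl⟩
    · left
      have : x = 0 := by omega
      simp [this]
  · rintro (rfl | ⟨j, hj, rfl | rfl⟩)
    · exact mem_latticePoints_two g
    · exact mem_latticePoints_one hj
    · exact mem_latticePoints_zero hj

/-! ### Convex sequences -/

/-- Slopes are decrements `f l - f (l+1)`. While they stay below `x`, each step strictly increases
`f l + l * x`. For a row of heights and a point of the plane with first coordinate `x`, this
compares the terms of that row. -/
theorem lt_of_forall_slope_lt {f : ℕ → ℝ} {x : ℝ} {i j : ℕ} (hij : i < j)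
    (h : ∀ l, i ≤ l → l < j → f l - f (l + 1) < x) : f i + i * x < f j + j * x := by
  induction j, hij using Nat.le_induction with
  | base =>
    have := h i le_rfl (Nat.lt_succ_self i)
    push_cast
    linarith
  | succ j hj ih =>
    have h1 := h j (by omega) (Nat.lt_succ_self j)
    have h2 := ih fun l hl hl' => h l hl (by omega)
    push_cast
    linarith

theorem lt_of_forall_lt_slope {f : ℕ → ℝ} {x : ℝ} {i j : ℕ} (hij : i < j)
    (h : ∀ l, i ≤ l → l < j → x < f l - f (l + 1)) : f j + j * x < f i + i * x := by
  induction j, hij using Nat.le_induction with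
  | base =>
    have := h i le_rfl (Nat.lt_succ_self i)
    push_cast
    linarith
  | succ j hj ih =>
    have h1 := h j (by omega) (Nat.lt_succ_self j)
    have h2 := ih fun l hl hl' => h l hl (by omega)
    push_cast
    linarith

/-! ### Heights inducing the triangulation -/

/-- Heights of the lattice points on the middle row. -/
def rowOne (ω : ℤ × ℤ → ℝ) (j : ℕ) : ℝ := ω (j, 1)

/-- Heights of the lattice points on the lower row. -/
def rowZero (ω : ℤ × ℤ → ℝ) (j : ℕ) : ℝ := ω (j, 0)

/-- The first coordinate of the vertices dual to the upper and middle triangle with index `j`. -/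
def slopeOne (ω : ℤ × ℤ → ℝ) (j : ℕ) : ℝ := rowOne ω j - rowOne ω (j + 1)

/-- The first coordinate of the vertex dual to the lower triangle with index `j`. -/
def slopeZero (ω : ℤ × ℤ → ℝ) (j : ℕ) : ℝ := rowZero ω j - rowZero ω (j + 1)

/-- The distance of the vertices dual to the upper and the middle triangle with index `j`. -/
def gap (ω : ℤ × ℤ → ℝ) (j : ℕ) : ℝ :=
  rowZero ω j - 2 * rowOne ω j - j * slopeOne ω j + ω (0, 2)

/-- The conditions on the heights for inducing the triangulation. -/
structure Admissible (g : ℕ) (ω : ℤ × ℤ → ℝ) : Prop where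
  gap_pos : ∀ j ≤ g, 0 < gap ω j
  slopeZero_lt : ∀ j ≤ g, slopeZero ω j < slopeOne ω j
  lt_slopeZero : ∀ j < g, slopeOne ω (j + 1) < slopeZero ω j

/-- The triangle with a given name. -/
def triangle {g : ℕ} : DualVertex g → Set (ℤ × ℤ)
  | .t j => {(0, 2), (↑(j : ℕ), 1), (↑(j : ℕ) + 1, 1)}
  | .m j => {(↑(j : ℕ), 0), (↑(j : ℕ), 1), (↑(j : ℕ) + 1, 1)}
  | .b j => {(↑(j : ℕ), 0), (↑(j : ℕ) + 1, 0), (↑(j : ℕ) + 1, 1)}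

/-- The vertex of the tropical curve dual to a triangle. -/
def position (ω : ℤ × ℤ → ℝ) {g : ℕ} : DualVertex g → ℝ × ℝ
  | .t j => (slopeOne ω j, rowOne ω j + (j : ℕ) * slopeOne ω j - ω (0, 2))
  | .m j => (slopeOne ω j, rowZero ω j - rowOne ω j)
  | .b j => (slopeZero ω j, rowZero ω (j + 1) - rowOne ω (j + 1))

theorem triangulationH_eq_range (g : ℕ) : triangulationH g = Set.range (triangle (g := g)) := by
  ext σ
  constructor
  · rintro ⟨j, h0, hj, h⟩
    lift j to ℕ using h0
    rcases h with rfl | rfl | rfl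
    · exact ⟨.t ⟨j, by omega⟩, rfl⟩
    · exact ⟨.m ⟨j, by omega⟩, rfl⟩
    · exact ⟨.b ⟨j, by omega⟩, rfl⟩
  · rintro ⟨⟨j, hj⟩ | ⟨j, hj⟩ | ⟨j, hj⟩, rfl⟩
    · exact ⟨j, by omega, by omega, Or.inl rfl⟩
    · exact ⟨j, by omega, by omega, Or.inr (Or.inl rfl)⟩
    · exact ⟨j, by omega, by omega, Or.inr (Or.inr rfl)⟩

theorem term_rowOne (ω : ℤ × ℤ → ℝ) (p : ℝ × ℝ) (j : ℕ) :
    term ω p (↑j, 1) = rowOne ω j + j * p.1 + p.2 := by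
  simp [term, rowOne]

theorem term_rowZero (ω : ℤ × ℤ → ℝ) (p : ℝ × ℝ) (j : ℕ) :
    term ω p (↑j, 0) = rowZero ω j + j * p.1 := by
  simp [term, rowZero]

theorem term_two (ω : ℤ × ℤ → ℝ) (p : ℝ × ℝ) : term ω p (0, 2) = ω (0, 2) + 2 * p.2 := by
  simp [term]

theorem mem_minTerms_iff {g : ℕ} {ω : ℤ × ℤ → ℝ} {p : ℝ × ℝ} {a : ℤ × ℤ}
    (ha : a ∈ latticePoints (polygonH g)) :
    a ∈ minTerms (latticePoints (polygonH g)) ω p ↔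
      term ω p a ≤ ω (0, 2) + 2 * p.2 ∧ ∀ j ≤ g + 1,
        term ω p a ≤ rowOne ω j + j * p.1 + p.2 ∧ term ω p a ≤ rowZero ω j + j * p.1 := by
  constructor
  · intro h
    refine ⟨term_two ω p ▸ h.2 _ (mem_latticePoints_two g), fun j hj => ⟨?_, ?_⟩⟩
    · exact term_rowOne ω p j ▸ h.2 _ (mem_latticePoints_one hj)
    · exact term_rowZero ω p j ▸ h.2 _ (mem_latticePoints_zero hj)
  · rintro ⟨h2, h⟩
    refine ⟨ha, fun b hb => ?_⟩
    rcases mem_latticePoints_iff.1 hb with rfl | ⟨j, hj, rfl | rfl⟩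
    · rw [term_two]; exact h2
    · rw [term_rowOne]; exact (h j hj).1
    · rw [term_rowZero]; exact (h j hj).2

namespace Admissible

variable {g : ℕ} {ω : ℤ × ℤ → ℝ}

theorem slopeOne_succ_lt (H : Admissible g ω) {j : ℕ} (hj : j < g) : slopeOne ω (j + 1) < slopeOne ω j :=
  (H.lt_slopeZero j hj).trans (H.slopeZero_lt j hj.le)

theorem slopeOne_le (H : Admissible g ω) {i j : ℕ} (hij : i ≤ j) (hj : j ≤ g) : slopeOne ω j ≤ slopeOne ω i := by
  induction j, hij using Nat.le_induction with
  | base => exact le_rfl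
  | succ j hij ih => exact (H.slopeOne_succ_lt (by omega)).le.trans (ih (by omega))

theorem slopeOne_lt (H : Admissible g ω) {i j : ℕ} (hij : i < j) (hj : j ≤ g) : slopeOne ω j < slopeOne ω i :=
  (H.slopeOne_le (Nat.succ_le_of_lt hij) hj).trans_lt (H.slopeOne_succ_lt (by omega))

theorem slopeOne_lt_slopeZero (H : Admissible g ω) {i j : ℕ} (hij : i < j) (hj : j ≤ g) :
    slopeOne ω j < slopeZero ω i :=
  (H.slopeOne_le (Nat.succ_le_of_lt hij) hj).trans_lt (H.lt_slopeZero i (by omega))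

theorem slopeZero_lt_slopeOne (H : Admissible g ω) {i j : ℕ} (hij : i ≤ j) (hj : j ≤ g) :
    slopeZero ω j < slopeOne ω i :=
  (H.slopeZero_lt j hj).trans_le (H.slopeOne_le hij hj)

theorem slopeZero_lt' (H : Admissible g ω) {i j : ℕ} (hij : i < j) (hj : j ≤ g) : slopeZero ω j < slopeZero ω i :=
  (H.slopeZero_lt j hj).trans (H.slopeOne_lt_slopeZero hij hj)

/-- On the middle row the heights are strictly convex. -/
theorem rowOne_lt (H : Admissible g ω) {j k : ℕ} (hj : j ≤ g) (hk : k ≤ g + 1) (h1 : k ≠ j) (h2 : k ≠ j + 1) :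
    rowOne ω j + j * slopeOne ω j < rowOne ω k + k * slopeOne ω j := by
  rcases lt_or_gt_of_ne h1 with h | h
  · exact lt_of_forall_lt_slope h fun l hl hl' => H.slopeOne_lt hl' hj
  · have := lt_of_forall_slope_lt (f := rowOne ω) (x := slopeOne ω j) (i := j + 1) (j := k)
      (by omega) fun l hl hl' => H.slopeOne_lt (i := j) (j := l) (by omega) (by omega)
    refine lt_of_eq_of_lt ?_ this
    unfold slopeOne
    push_cast
    ring

/-- On the lower row the heights are strictly convex. -/
theorem rowZero_lt (H : Admissible g ω) {j k : ℕ} (hj : j ≤ g) (hk : k ≤ g + 1) (h1 : k ≠ j) (h2 : k ≠ j + 1) :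
    rowZero ω j + j * slopeZero ω j < rowZero ω k + k * slopeZero ω j := by
  rcases lt_or_gt_of_ne h1 with h | h
  · exact lt_of_forall_lt_slope h fun l hl hl' => H.slopeZero_lt' hl' hj
  · have := lt_of_forall_slope_lt (f := rowZero ω) (x := slopeZero ω j) (i := j + 1) (j := k)
      (by omega) fun l hl hl' => H.slopeZero_lt' (i := j) (j := l) (by omega) (by omega)
    refine lt_of_eq_of_lt ?_ this
    unfold slopeZero
    push_cast
    ring

theorem rowZero_lt_at_slopeOne (H : Admissible g ω) {j k : ℕ} (hj : j ≤ g) (hk : k ≤ g + 1) (h1 : k ≠ j) :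
    rowZero ω j + j * slopeOne ω j < rowZero ω k + k * slopeOne ω j := by
  rcases lt_or_gt_of_ne h1 with h | h
  · exact lt_of_forall_lt_slope h fun l hl hl' => H.slopeOne_lt_slopeZero hl' hj
  · exact lt_of_forall_slope_lt h fun l hl hl' => H.slopeZero_lt_slopeOne hl (by omega)

theorem rowOne_lt_at_slopeZero (H : Admissible g ω) {j k : ℕ} (hj : j ≤ g) (hk : k ≤ g + 1) (h1 : k ≠ j + 1) :
    rowOne ω (j + 1) + (j + 1 : ℕ) * slopeZero ω j < rowOne ω k + k * slopeZero ω j := by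
  rcases lt_or_gt_of_ne h1 with h | h
  · exact lt_of_forall_lt_slope h fun l hl hl' => H.slopeZero_lt_slopeOne (by omega) hj
  · exact lt_of_forall_slope_lt h fun l hl hl' => H.slopeOne_lt_slopeZero hl (by omega)

/-- The middle row lies strictly below the segments joining the lower row with the top vertex. -/
theorem midpoint_lt (H : Admissible g ω) {k : ℕ} (hk : 2 * k ≤ g + 1) :
    2 * rowOne ω k < ω (0, 2) + rowZero ω (2 * k) := by
  induction k with
  | zero =>
    have := H.gap_pos 0 (Nat.zero_le g)
    simp only [gap, Nat.cast_zero, zero_mul, sub_zero] at this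
    simp only [mul_zero]
    linarith
  | succ k ih =>
    have h0 := ih (by omega)
    -- Passing from `k` to `k+1` lowers the left side by `2 * s k` and the right side by `r (2k) + r
    -- (2k+1)`. Both of the latter slopes are below `s k`, so the inequality improves.
    have h1 := H.slopeZero_lt_slopeOne (i := k) (j := 2 * k) (by omega) (by omega)
    have h2 := H.slopeZero_lt_slopeOne (i := k) (j := 2 * k + 1) (by omega) (by omega)
    have e : 2 * (k + 1) = 2 * k + 1 + 1 := by ring
    rw [e]
    unfold slopeZero slopeOne at *
    linarith

theorem midpoint_lt' (H : Admissible g ω) {k : ℕ} (hk : 2 * k + 1 ≤ g + 1) :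
    rowOne ω k + rowOne ω (k + 1) < ω (0, 2) + rowZero ω (2 * k + 1) := by
  have h0 := H.midpoint_lt (k := k) (by omega)
  have h1 := H.slopeZero_lt_slopeOne (i := k) (j := 2 * k) (by omega) (by omega)
  unfold slopeZero slopeOne at *
  linarith

/-- The top vertex and a point of the lower row are never both minimal. -/
theorem not_mem_two (H : Admissible g ω) {p : ℝ × ℝ} {i : ℕ} (hi : i ≤ g + 1)
    (h0 : ((i : ℤ), (0 : ℤ)) ∈ minTerms (latticePoints (polygonH g)) ω p) :
    ((0 : ℤ), (2 : ℤ)) ∉ minTerms (latticePoints (polygonH g)) ω p := by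
  intro h2
  obtain ⟨h2', h2⟩ := (mem_minTerms_iff (mem_latticePoints_two g)).1 h2
  obtain ⟨h0', h0⟩ := (mem_minTerms_iff (mem_latticePoints_zero hi)).1 h0
  rw [term_two] at h2
  rw [term_rowZero] at h0
  -- The midpoint of `(0,2)` and `(i,0)` is `(k,1)` for `i = 2k`, and the midpoint of `(k,1)` and
  -- `(k+1,1)` for `i = 2k+1`. Middle-row terms would fall strictly below the supposed minimum.
  obtain ⟨k, rfl | rfl⟩ : ∃ k, i = 2 * k ∨ i = 2 * k + 1 := ⟨i / 2, by omega⟩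
  · have h := H.midpoint_lt hi
    have h3 := (h2 k (by omega)).1
    have h4 := (h0 k (by omega)).1
    push_cast at *
    linarith
  · have h := H.midpoint_lt' hi
    have h3 := (h2 k (by omega)).1
    have h4 := (h0 k (by omega)).1
    have h5 := (h2 (k + 1) (by omega)).1
    have h6 := (h0 (k + 1) (by omega)).1
    push_cast at *
    linarith

end Admissible

/-! ### Vertices of the tropical curve -/

theorem minTerms_eq {A σ : Set (ℤ × ℤ)} {ω : ℤ × ℤ → ℝ} {p : ℝ × ℝ} {V : ℝ} (hσ : σ ⊆ A)
    (hne : σ.Nonempty) (h1 : ∀ a ∈ σ, term ω p a = V) (h2 : ∀ a ∈ A, a ∉ σ → V < term ω p a) :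
    minTerms A ω p = σ := by
  ext a
  constructor
  · rintro ⟨ha, h⟩
    by_contra hn
    obtain ⟨b, hb⟩ := hne
    have h3 := h b (hσ hb)
    rw [h1 b hb] at h3
    exact (h2 a ha hn).not_ge h3
  · intro ha
    refine ⟨hσ ha, fun b hb => ?_⟩
    rw [h1 a ha]
    by_cases hb' : b ∈ σ
    · exact (h1 b hb').ge
    · exact (h2 b hb hb').le

theorem term_eq_of_mem {A : Set (ℤ × ℤ)} {ω : ℤ × ℤ → ℝ} {p : ℝ × ℝ} {a b : ℤ × ℤ}
    (ha : a ∈ minTerms A ω p) (hb : b ∈ minTerms A ω p) : term ω p a = term ω p b :=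
  le_antisymm (ha.2 b hb.1) (hb.2 a ha.1)

theorem term_lt_of_not_mem {A : Set (ℤ × ℤ)} {ω : ℤ × ℤ → ℝ} {p : ℝ × ℝ} {a b : ℤ × ℤ}
    (ha : a ∈ minTerms A ω p) (hb : b ∈ A) (hb' : b ∉ minTerms A ω p) :
    term ω p a < term ω p b := by
  by_contra h
  exact hb' ⟨hb, fun c hc => (not_lt.1 h).trans (ha.2 c hc)⟩

theorem collinear_row {S : Set (ℤ × ℤ)} {c : ℤ} (h : ∀ a ∈ S, a.2 = c) :
    Collinear ℝ (toPlane '' S) := by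
  rw [collinear_iff_exists_forall_eq_smul_vadd]
  refine ⟨(0, c), (1, 0), ?_⟩
  rintro _ ⟨a, ha, rfl⟩
  refine ⟨a.1, ?_⟩
  simp [toPlane, h a ha]

theorem collinear_of_subset_pair {S : Set (ℤ × ℤ)} {a b : ℤ × ℤ} (h : ∀ c ∈ S, c = a ∨ c = b) :
    Collinear ℝ (toPlane '' S) := by
  refine (collinear_pair ℝ (toPlane a) (toPlane b)).subset ?_
  rintro _ ⟨c, hc, rfl⟩
  rcases h c hc with rfl | rfl <;> simp

theorem not_collinear_of_det {S : Set (ℤ × ℤ)} {a b c : ℤ × ℤ} (ha : a ∈ S) (hb : b ∈ S)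
    (hc : c ∈ S) (hdet : (b.1 - a.1) * (c.2 - a.2) - (b.2 - a.2) * (c.1 - a.1) ≠ 0) :
    ¬ Collinear ℝ (toPlane '' S) := by
  intro h
  rw [collinear_iff_of_mem (Set.mem_image_of_mem toPlane ha)] at h
  obtain ⟨v, hv⟩ := h
  obtain ⟨r, hr⟩ := hv _ ⟨b, hb, rfl⟩
  obtain ⟨s, hs⟩ := hv _ ⟨c, hc, rfl⟩
  simp only [toPlane, vadd_eq_add, Prod.ext_iff, Prod.fst_add, Prod.snd_add, Prod.smul_fst,
    Prod.smul_snd, smul_eq_mul] at hr hs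
  apply hdet
  have : ((b.1 : ℝ) - a.1) * (c.2 - a.2) - (b.2 - a.2) * (c.1 - a.1) = 0 := by
    rw [hr.1, hr.2, hs.1, hs.2]
    ring
  exact_mod_cast this

theorem nontrivial_of_not_collinear {S : Set (ℤ × ℤ)} (h : ¬ Collinear ℝ (toPlane '' S)) :
    S.Nontrivial := by
  by_contra hn
  rw [Set.not_nontrivial_iff] at hn
  exact h ((hn.image toPlane).induction_on (collinear_empty ℝ _) fun p => collinear_singleton ℝ p)

theorem mem_curveVertices_iff {A : Set (ℤ × ℤ)} {ω : ℤ × ℤ → ℝ} {p : ℝ × ℝ} :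
    p ∈ curveVertices A ω ↔ ¬ Collinear ℝ (toPlane '' minTerms A ω p) :=
  ⟨fun h => h.2, fun h => ⟨nontrivial_of_not_collinear h, h⟩⟩

theorem not_collinear_triangle {g : ℕ} (v : DualVertex g) :
    ¬ Collinear ℝ (toPlane '' triangle v) := by
  rcases v with j | j | j
  · refine not_collinear_of_det (a := (0, 2)) (b := (↑(j : ℕ), 1)) (c := (↑(j : ℕ) + 1, 1))
      (by simp [triangle]) (by simp [triangle]) (by simp [triangle]) ?_
    ring_nf
    norm_num
  · refine not_collinear_of_det (a := (↑(j : ℕ), 0)) (b := (↑(j : ℕ), 1)) (c := (↑(j : ℕ) + 1, 1))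
      (by simp [triangle]) (by simp [triangle]) (by simp [triangle]) ?_
    ring_nf
    norm_num
  · refine not_collinear_of_det (a := (↑(j : ℕ), 0)) (b := (↑(j : ℕ) + 1, 0))
      (c := (↑(j : ℕ) + 1, 1))
      (by simp [triangle]) (by simp [triangle]) (by simp [triangle]) ?_
    ring_nf
    norm_num

theorem triangle_subset {g : ℕ} (v : DualVertex g) : triangle v ⊆ latticePoints (polygonH g) := by
  intro a ha
  rw [mem_latticePoints_iff]
  rcases v with ⟨j, hj⟩ | ⟨j, hj⟩ | ⟨j, hj⟩ <;> rcases ha with rfl | rfl | rfl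
  · exact Or.inl rfl
  · exact Or.inr ⟨j, by omega, Or.inl rfl⟩
  · exact Or.inr ⟨j + 1, by omega, Or.inl (by simp)⟩
  · exact Or.inr ⟨j, by omega, Or.inr rfl⟩
  · exact Or.inr ⟨j, by omega, Or.inl rfl⟩
  · exact Or.inr ⟨j + 1, by omega, Or.inl (by simp)⟩
  · exact Or.inr ⟨j, by omega, Or.inr rfl⟩
  · exact Or.inr ⟨j + 1, by omega, Or.inr (by simp)⟩
  · exact Or.inr ⟨j + 1, by omega, Or.inl (by simp)⟩

theorem triangle_nonempty {g : ℕ} (v : DualVertex g) : (triangle v).Nonempty := by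
  rcases v with j | j | j <;> exact ⟨_, Or.inl rfl⟩

namespace Admissible

variable {g : ℕ} {ω : ℤ × ℤ → ℝ}

/-- At the dual point the three corners share the value `V`. Strict convexity of the rows handles
the other lattice points of the two rows, with `gap_pos` for comparisons between the top vertex and
the lower row. -/
theorem minTerms_position (H : Admissible g ω) (v : DualVertex g) :
    minTerms (latticePoints (polygonH g)) ω (position ω v) = triangle v := by
  have hcast : ∀ j : ℕ, ((j : ℤ) + 1) = ((j + 1 : ℕ) : ℤ) := fun j => by push_cast; rfl
  rcases v with ⟨j, hj⟩ | ⟨j, hj⟩ | ⟨j, hj⟩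
  · have hj' : j ≤ g := by omega
    refine minTerms_eq (V := 2 * (rowOne ω j + j * slopeOne ω j) - ω (0, 2)) (triangle_subset _)
      (triangle_nonempty _) ?_ ?_
    · rintro a (rfl | rfl | rfl)
      · rw [term_two]; simp only [position]; ring
      · rw [term_rowOne]; simp only [position]; ring
      · simp only [hcast]
        rw [term_rowOne]; simp only [position, slopeOne]; push_cast; ring
    · intro a ha hn
      simp only [triangle, Set.mem_insert_iff, Set.mem_singleton_iff, not_or] at hn
      rcases mem_latticePoints_iff.1 ha with rfl | ⟨k, hk, rfl | rfl⟩
      · exact absurd rfl hn.1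
      · have h1 : k ≠ j := fun h => hn.2.1 (by rw [h])
        have h2 : k ≠ j + 1 := fun h => hn.2.2 (by rw [h]; push_cast; rfl)
        have := H.rowOne_lt hj' hk h1 h2
        rw [term_rowOne]; simp only [position]; linarith
      · rw [term_rowZero]; simp only [position]
        have hgap := H.gap_pos j hj'
        unfold gap at hgap
        rcases eq_or_ne k j with rfl | h1
        · linarith
        · have := H.rowZero_lt_at_slopeOne hj' hk h1
          linarith
  · have hj' : j ≤ g := by omega
    refine minTerms_eq (V := rowZero ω j + j * slopeOne ω j) (triangle_subset _)
      (triangle_nonempty _) ?_ ?_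
    · rintro a (rfl | rfl | rfl)
      · rw [term_rowZero]; simp only [position]
      · rw [term_rowOne]; simp only [position]; ring
      · simp only [hcast]
        rw [term_rowOne]; simp only [position, slopeOne]; push_cast; ring
    · intro a ha hn
      simp only [triangle, Set.mem_insert_iff, Set.mem_singleton_iff, not_or] at hn
      rcases mem_latticePoints_iff.1 ha with rfl | ⟨k, hk, rfl | rfl⟩
      · have hgap := H.gap_pos j hj'
        unfold gap at hgap
        rw [term_two]; simp only [position]; linarith
      · have h1 : k ≠ j := fun h => hn.2.1 (by rw [h])
        have h2 : k ≠ j + 1 := fun h => hn.2.2 (by rw [h]; push_cast; rfl)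
        have := H.rowOne_lt hj' hk h1 h2
        rw [term_rowOne]; simp only [position]; linarith
      · have h1 : k ≠ j := fun h => hn.1 (by rw [h])
        have := H.rowZero_lt_at_slopeOne hj' hk h1
        rw [term_rowZero]; simp only [position]; linarith
  · have hj' : j ≤ g := by omega
    refine minTerms_eq (V := rowZero ω j + j * slopeZero ω j) (triangle_subset _)
      (triangle_nonempty _) ?_ ?_
    · rintro a (rfl | rfl | rfl)
      · rw [term_rowZero]; simp only [position]
      · simp only [hcast]
        rw [term_rowZero]; simp only [position, slopeZero]; push_cast; ring
      · simp only [hcast]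
        rw [term_rowOne]; simp only [position, slopeZero]; push_cast; ring
    · intro a ha hn
      simp only [triangle, Set.mem_insert_iff, Set.mem_singleton_iff, not_or] at hn
      rcases mem_latticePoints_iff.1 ha with rfl | ⟨k, hk, rfl | rfl⟩
      -- The term of the top vertex exceeds `V` by `gap j + (j+2) * (s j - r j)`.
      · have hgap := H.gap_pos j hj'
        have hs := mul_pos (show (0 : ℝ) < j + 2 by positivity)
          (sub_pos.2 (H.slopeZero_lt j hj'))
        unfold gap at hgap
        rw [term_two]; simp only [position]
        simp only [slopeOne, slopeZero] at *
        linarith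
      · have h2 : k ≠ j + 1 := fun h => hn.2.2 (by rw [h]; push_cast; rfl)
        have := H.rowOne_lt_at_slopeZero hj' hk h2
        rw [term_rowOne]; simp only [position]
        simp only [slopeZero] at *
        push_cast at this
        linarith
      · have h1 : k ≠ j := fun h => hn.1 (by rw [h])
        have h2 : k ≠ j + 1 := fun h => hn.2.1 (by rw [h]; push_cast; rfl)
        have := H.rowZero_lt hj' hk h1 h2
        rw [term_rowZero]; simp only [position]; linarith

/-- Minimality at `k` and at `k' = l+1` gives `s k ≤ p.1 ≤ s l`. The slopes decrease strictly, so `l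
= k` and the first coordinate is determined. -/
theorem rowOne_pair (H : Admissible g ω) {p : ℝ × ℝ} {k k' : ℕ} (hkk : k < k') (hk' : k' ≤ g + 1)
    (h : ((k : ℤ), (1 : ℤ)) ∈ minTerms (latticePoints (polygonH g)) ω p)
    (h' : ((k' : ℤ), (1 : ℤ)) ∈ minTerms (latticePoints (polygonH g)) ω p) :
    k' = k + 1 ∧ p.1 = slopeOne ω k := by
  obtain ⟨l, rfl⟩ : ∃ l, k' = l + 1 := ⟨k' - 1, by omega⟩
  have h1 := h.2 _ (mem_latticePoints_one (j := k + 1) (by omega))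
  have h2 := h'.2 _ (mem_latticePoints_one (j := l) (by omega))
  rw [term_rowOne, term_rowOne] at h1 h2
  push_cast at h1 h2
  have h3 : slopeOne ω k ≤ p.1 := by unfold slopeOne; linarith
  have h4 : p.1 ≤ slopeOne ω l := by unfold slopeOne; linarith
  have hlk : l = k := by
    by_contra hne
    have := H.slopeOne_lt (i := k) (j := l) (by omega) (by omega)
    linarith
  subst hlk
  exact ⟨rfl, le_antisymm h4 h3⟩

theorem rowZero_pair (H : Admissible g ω) {p : ℝ × ℝ} {k k' : ℕ} (hkk : k < k')
    (hk' : k' ≤ g + 1)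
    (h : ((k : ℤ), (0 : ℤ)) ∈ minTerms (latticePoints (polygonH g)) ω p)
    (h' : ((k' : ℤ), (0 : ℤ)) ∈ minTerms (latticePoints (polygonH g)) ω p) :
    k' = k + 1 ∧ p.1 = slopeZero ω k := by
  obtain ⟨l, rfl⟩ : ∃ l, k' = l + 1 := ⟨k' - 1, by omega⟩
  have h1 := h.2 _ (mem_latticePoints_zero (j := k + 1) (by omega))
  have h2 := h'.2 _ (mem_latticePoints_zero (j := l) (by omega))
  rw [term_rowZero, term_rowZero] at h1 h2
  push_cast at h1 h2
  have h3 : slopeZero ω k ≤ p.1 := by unfold slopeZero; linarith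
  have h4 : p.1 ≤ slopeZero ω l := by unfold slopeZero; linarith
  have hlk : l = k := by
    by_contra hne
    have := H.slopeZero_lt' (i := k) (j := l) (by omega) (by omega)
    linarith
  subst hlk
  exact ⟨rfl, le_antisymm h4 h3⟩

/-- The vertices of the curve are dual to the triangles. -/
theorem exists_position (H : Admissible g ω) {p : ℝ × ℝ}
    (hp : ¬ Collinear ℝ (toPlane '' minTerms (latticePoints (polygonH g)) ω p)) :
    ∃ v : DualVertex g, p = position ω v := by
  set S := minTerms (latticePoints (polygonH g)) ω p with hS
  have hsub : ∀ a ∈ S, a = (0, 2) ∨ ∃ j : ℕ, j ≤ g + 1 ∧ (a = (↑j, 1) ∨ a = (↑j, 0)) :=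
    fun a ha => mem_latticePoints_iff.1 ha.1
  -- If a lower point is minimal, the top vertex is not. Non-collinearity then forces minimal points
  -- on both remaining rows and two on one of them: a lower triangle (`hlow`) or a middle one
  -- (`hmid`). Otherwise the top vertex is minimal together with two points of the middle row
  -- (`hup`).
  by_cases hA : ∃ i : ℕ, i ≤ g + 1 ∧ ((i : ℤ), (0 : ℤ)) ∈ S
  · obtain ⟨i, hi, hiS⟩ := hA
    have h2 : ((0 : ℤ), (2 : ℤ)) ∉ S := H.not_mem_two hi hiS
    obtain ⟨k, hk, hkS⟩ : ∃ k : ℕ, k ≤ g + 1 ∧ ((k : ℤ), (1 : ℤ)) ∈ S := by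
      by_contra hn
      refine hp (collinear_row (c := 0) fun a ha => ?_)
      rcases hsub a ha with rfl | ⟨j, hj, rfl | rfl⟩
      · exact absurd ha h2
      · exact absurd ⟨j, hj, ha⟩ hn
      · rfl
    have hlow : ∀ l l' : ℕ, l < l' → l' ≤ g + 1 → ((l : ℤ), (0 : ℤ)) ∈ S →
        ((l' : ℤ), (0 : ℤ)) ∈ S → ∃ v : DualVertex g, p = position ω v := by
      intro l l' hll hl' hl hl''
      obtain ⟨rfl, hx⟩ := H.rowZero_pair hll hl' hl hl''
      have hkl : k = l + 1 := by
        by_contra hne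
        have h3 := H.rowOne_lt_at_slopeZero (j := l) (by omega) hk hne
        have h4 := hkS.2 _ (mem_latticePoints_one (j := l + 1) hl')
        rw [term_rowOne, term_rowOne, hx] at h4
        linarith
      subst hkl
      refine ⟨.b ⟨l, by omega⟩, Prod.ext hx ?_⟩
      have h5 := term_eq_of_mem hkS hl''
      rw [term_rowOne, term_rowZero] at h5
      simp only [position]
      linarith
    by_cases hA1 : ∃ i' : ℕ, i' ≤ g + 1 ∧ i' ≠ i ∧ ((i' : ℤ), (0 : ℤ)) ∈ S
    · obtain ⟨i', hi', hne, hiS'⟩ := hA1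
      rcases lt_or_gt_of_ne hne with h | h
      · exact hlow i' i h hi hiS' hiS
      · exact hlow i i' h hi' hiS hiS'
    · obtain ⟨k', hk', hne, hkS'⟩ :
          ∃ k' : ℕ, k' ≤ g + 1 ∧ k' ≠ k ∧ ((k' : ℤ), (1 : ℤ)) ∈ S := by
        by_contra hn
        refine hp (collinear_of_subset_pair (a := (↑i, 0)) (b := (↑k, 1)) fun a ha => ?_)
        rcases hsub a ha with rfl | ⟨j, hj, rfl | rfl⟩
        · exact absurd ha h2
        · right
          by_cases hjk : j = k
          · rw [hjk]
          · exact absurd ⟨j, hj, hjk, ha⟩ hn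
        · left
          by_cases hji : j = i
          · rw [hji]
          · exact absurd ⟨j, hj, hji, ha⟩ hA1
      have hmid : ∀ l l' : ℕ, l < l' → l' ≤ g + 1 → ((l : ℤ), (1 : ℤ)) ∈ S →
          ((l' : ℤ), (1 : ℤ)) ∈ S → ∃ v : DualVertex g, p = position ω v := by
        intro l l' hll hl' hl hl''
        obtain ⟨rfl, hx⟩ := H.rowOne_pair hll hl' hl hl''
        have hil : i = l := by
          by_contra hne
          have h3 := H.rowZero_lt_at_slopeOne (j := l) (by omega) hi hne
          have h4 := hiS.2 _ (mem_latticePoints_zero (j := l) (by omega))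
          rw [term_rowZero, term_rowZero, hx] at h4
          linarith
        subst hil
        refine ⟨.m ⟨i, by omega⟩, Prod.ext hx ?_⟩
        have h5 := term_eq_of_mem hl hiS
        rw [term_rowOne, term_rowZero] at h5
        simp only [position]
        linarith
      rcases lt_or_gt_of_ne hne with h | h
      · exact hmid k' k h hk hkS' hkS
      · exact hmid k k' h hk' hkS hkS'
  · have hrow : ∀ a ∈ S, a = (0, 2) ∨ ∃ j : ℕ, j ≤ g + 1 ∧ a = (↑j, 1) := by
      intro a ha
      rcases hsub a ha with rfl | ⟨j, hj, rfl | rfl⟩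
      · exact Or.inl rfl
      · exact Or.inr ⟨j, hj, rfl⟩
      · exact absurd ⟨j, hj, ha⟩ hA
    have h2 : ((0 : ℤ), (2 : ℤ)) ∈ S := by
      by_contra hn
      refine hp (collinear_row (c := 1) fun a ha => ?_)
      rcases hrow a ha with rfl | ⟨j, hj, rfl⟩
      · exact absurd ha hn
      · rfl
    obtain ⟨k, hk, hkS⟩ : ∃ k : ℕ, k ≤ g + 1 ∧ ((k : ℤ), (1 : ℤ)) ∈ S := by
      by_contra hn
      refine hp (collinear_row (c := 2) fun a ha => ?_)
      rcases hrow a ha with rfl | ⟨j, hj, rfl⟩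
      · rfl
      · exact absurd ⟨j, hj, ha⟩ hn
    obtain ⟨k', hk', hne, hkS'⟩ :
        ∃ k' : ℕ, k' ≤ g + 1 ∧ k' ≠ k ∧ ((k' : ℤ), (1 : ℤ)) ∈ S := by
      by_contra hn
      refine hp (collinear_of_subset_pair (a := (0, 2)) (b := (↑k, 1)) fun a ha => ?_)
      rcases hrow a ha with rfl | ⟨j, hj, rfl⟩
      · exact Or.inl rfl
      · right
        by_cases hjk : j = k
        · rw [hjk]
        · exact absurd ⟨j, hj, hjk, ha⟩ hn
    have hup : ∀ l l' : ℕ, l < l' → l' ≤ g + 1 → ((l : ℤ), (1 : ℤ)) ∈ S →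
        ((l' : ℤ), (1 : ℤ)) ∈ S → ∃ v : DualVertex g, p = position ω v := by
      intro l l' hll hl' hl hl''
      obtain ⟨rfl, hx⟩ := H.rowOne_pair hll hl' hl hl''
      refine ⟨.t ⟨l, by omega⟩, Prod.ext hx ?_⟩
      have h5 := term_eq_of_mem hl h2
      rw [term_rowOne, term_two, hx] at h5
      simp only [position]
      linarith
    rcases lt_or_gt_of_ne hne with h | h
    · exact hup k' k h hk hkS' hkS
    · exact hup k k' h hk' hkS hkS'

theorem curveVertices_eq (H : Admissible g ω) :
    curveVertices (latticePoints (polygonH g)) ω = Set.range (position ω (g := g)) := by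
  ext p
  rw [mem_curveVertices_iff]
  constructor
  · intro hp
    obtain ⟨v, rfl⟩ := H.exists_position hp
    exact ⟨v, rfl⟩
  · rintro ⟨v, rfl⟩
    rw [H.minTerms_position]
    exact not_collinear_triangle v

theorem induces (H : Admissible g ω) : Induces (polygonH g) ω (triangulationH g) := by
  unfold Induces
  rw [H.curveVertices_eq, triangulationH_eq_range, ← Set.range_comp]
  congr 1
  funext v
  exact H.minTerms_position v

end Admissible

/-- Each inequality is the strict comparison, at the vertex dual to a triangle, with one lattice
point outside it: `(0,2)` for the middle triangle gives the gap, and `(j,1)` and `(j+2,1)` for the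
lower triangle give the bounds on its slope. -/
theorem Induces.admissible {g : ℕ} {ω : ℤ × ℤ → ℝ}
    (h : Induces (polygonH g) ω (triangulationH g)) : Admissible g ω := by
  have hex : ∀ v : DualVertex g, ∃ p, minTerms (latticePoints (polygonH g)) ω p = triangle v := by
    intro v
    have hv : triangle v ∈ triangulationH g := by rw [triangulationH_eq_range]; exact ⟨v, rfl⟩
    rw [← h] at hv
    obtain ⟨p, -, hp⟩ := hv
    exact ⟨p, hp⟩
  refine ⟨fun j hj => ?_, fun j hj => ?_, fun j hj => ?_⟩
  · obtain ⟨p, hp⟩ := hex (.m ⟨j, by omega⟩)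
    have h0 : ((j : ℤ), (0 : ℤ)) ∈ minTerms (latticePoints (polygonH g)) ω p := by
      rw [hp]; simp [triangle]
    have h1 : ((j : ℤ), (1 : ℤ)) ∈ minTerms (latticePoints (polygonH g)) ω p := by
      rw [hp]; simp [triangle]
    have h2 : (((j + 1 : ℕ) : ℤ), (1 : ℤ)) ∈ minTerms (latticePoints (polygonH g)) ω p := by
      rw [hp]; simp [triangle]
    have h3 := term_lt_of_not_mem h1 (mem_latticePoints_two g) (by rw [hp]; simp [triangle])
    have h4 := term_eq_of_mem h0 h1
    have h5 := term_eq_of_mem h1 h2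
    rw [term_rowZero, term_rowOne] at h4
    rw [term_rowOne, term_rowOne] at h5
    rw [term_rowOne, term_two] at h3
    push_cast at h5
    have hx : p.1 = slopeOne ω j := by unfold slopeOne; linarith
    rw [hx] at h3
    unfold gap
    linarith
  · obtain ⟨p, hp⟩ := hex (.b ⟨j, by omega⟩)
    have h0 : ((j : ℤ), (0 : ℤ)) ∈ minTerms (latticePoints (polygonH g)) ω p := by
      rw [hp]; simp [triangle]
    have h1 : (((j + 1 : ℕ) : ℤ), (0 : ℤ)) ∈ minTerms (latticePoints (polygonH g)) ω p := by
      rw [hp]; simp [triangle]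
    have h2 : (((j + 1 : ℕ) : ℤ), (1 : ℤ)) ∈ minTerms (latticePoints (polygonH g)) ω p := by
      rw [hp]; simp [triangle]
    have h3 := term_lt_of_not_mem h2 (mem_latticePoints_one (j := j) (by omega))
      (by rw [hp]; simp [triangle])
    have h4 := term_eq_of_mem h0 h1
    rw [term_rowZero, term_rowZero] at h4
    rw [term_rowOne, term_rowOne] at h3
    push_cast at h3 h4
    unfold slopeZero slopeOne
    linarith
  · obtain ⟨p, hp⟩ := hex (.b ⟨j, by omega⟩)
    have h0 : ((j : ℤ), (0 : ℤ)) ∈ minTerms (latticePoints (polygonH g)) ω p := by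
      rw [hp]; simp [triangle]
    have h1 : (((j + 1 : ℕ) : ℤ), (0 : ℤ)) ∈ minTerms (latticePoints (polygonH g)) ω p := by
      rw [hp]; simp [triangle]
    have h2 : (((j + 1 : ℕ) : ℤ), (1 : ℤ)) ∈ minTerms (latticePoints (polygonH g)) ω p := by
      rw [hp]; simp [triangle]
    have h3 := term_lt_of_not_mem h2 (mem_latticePoints_one (j := j + 1 + 1) (by omega))
      (by rw [hp]; simp [triangle])
    have h4 := term_eq_of_mem h0 h1
    rw [term_rowZero, term_rowZero] at h4
    rw [term_rowOne, term_rowOne] at h3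
    push_cast at h3 h4
    unfold slopeZero slopeOne
    linarith

/-! ### The graph of bounded edges of the tropical curve -/

theorem triangle_injective {g : ℕ} : Function.Injective (triangle (g := g)) := by
  intro v w h
  have hsub : ∀ a, a ∈ triangle v ↔ a ∈ triangle w := fun a => by rw [h]
  rcases v with ⟨j, hj⟩ | ⟨j, hj⟩ | ⟨j, hj⟩ <;> rcases w with ⟨k, hk⟩ | ⟨k, hk⟩ | ⟨k, hk⟩ <;>
  · have h1 := hsub (j, 1)
    have h2 := hsub (j + 1, 1)
    have h3 := hsub (j, 0)
    have h4 := hsub (j + 1, 0)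
    have h5 := hsub (0, 2)
    simp only [triangle, Set.mem_insert_iff, Set.mem_singleton_iff, Prod.mk.injEq,
      true_iff, iff_true, and_true, true_and, true_or, or_true] at h1 h2 h3 h4 h5
    simp only [DualVertex.t.injEq, DualVertex.m.injEq, DualVertex.b.injEq, Fin.ext_iff,
      reduceCtorEq]
    omega

/-- `BoundedEdge` only asks for two common minimal terms; distinct triangles with two common corners
share an interior edge of the triangulation. -/
theorem exists_ends_of_nontrivial {g : ℕ} {v w : DualVertex g} (hne : v ≠ w)
    (h : (triangle v ∩ triangle w).Nontrivial) : ∃ e, (dualGraph g).ends e = s(v, w) := by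
  obtain ⟨⟨a, a'⟩, ⟨ha, ha'⟩, ⟨b, b'⟩, ⟨hb, hb'⟩, hab⟩ := h
  rcases v with ⟨j, hj⟩ | ⟨j, hj⟩ | ⟨j, hj⟩ <;> rcases w with ⟨k, hk⟩ | ⟨k, hk⟩ | ⟨k, hk⟩ <;>
  simp only [triangle, Set.mem_insert_iff, Set.mem_singleton_iff, Prod.mk.injEq, ne_eq,
    DualVertex.t.injEq, DualVertex.m.injEq, DualVertex.b.injEq, Fin.ext_iff, reduceCtorEq,
    not_false_eq_true] at ha ha' hb hb' hab hne
  · have : k = j + 1 ∨ j = k + 1 := by omega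
    rcases this with rfl | rfl
    · exact ⟨.tt ⟨j, by omega⟩, rfl⟩
    · exact ⟨.tt ⟨k, by omega⟩, Sym2.eq_swap⟩
  · obtain rfl : j = k := by omega
    exact ⟨.tm ⟨j, hj⟩, rfl⟩
  · omega
  · obtain rfl : j = k := by omega
    exact ⟨.tm ⟨j, hj⟩, Sym2.eq_swap⟩
  · omega
  · have : k = j ∨ j = k + 1 := by omega
    rcases this with rfl | rfl
    · exact ⟨.mb ⟨k, hk⟩, rfl⟩
    · exact ⟨.bm ⟨k, by omega⟩, Sym2.eq_swap⟩
  · omega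
  · have : k = j ∨ k = j + 1 := by omega
    rcases this with rfl | rfl
    · exact ⟨.mb ⟨k, hk⟩, Sym2.eq_swap⟩
    · exact ⟨.bm ⟨j, by omega⟩, rfl⟩
  · omega

theorem exists_ends_dualGraph {g : ℕ} (e : DualEdge g) : ∃ v w, (dualGraph g).ends e = s(v, w) ∧
    v ≠ w ∧ (triangle v ∩ triangle w).Nontrivial := by
  rcases e with j | j | j | j
  · refine ⟨_, _, rfl, by simp [Fin.ext_iff], (0, 2), ?_, (j + 1, 1), ?_, ?_⟩ <;> simp [triangle]
  · refine ⟨_, _, rfl, by simp, (j, 1), ?_, (j + 1, 1), ?_, ?_⟩ <;> simp [triangle]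
  · refine ⟨_, _, rfl, by simp, (j, 0), ?_, (j + 1, 1), ?_, ?_⟩ <;> simp [triangle]
  · refine ⟨_, _, rfl, by simp, (j + 1, 0), ?_, (j + 1, 1), ?_, ?_⟩ <;> simp [triangle]

theorem ends_dualGraph_injective {g : ℕ} : Function.Injective (dualGraph g).ends := by
  intro e e' h
  rcases e with ⟨j, hj⟩ | ⟨j, hj⟩ | ⟨j, hj⟩ | ⟨j, hj⟩ <;>
  rcases e' with ⟨k, hk⟩ | ⟨k, hk⟩ | ⟨k, hk⟩ | ⟨k, hk⟩ <;>
  simp only [dualGraph, Sym2.eq_iff, DualVertex.t.injEq, DualVertex.m.injEq, DualVertex.b.injEq,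
    Fin.ext_iff, reduceCtorEq, Fin.val_castSucc, Fin.val_succ, and_false, false_and, or_self,
    or_false, false_or] at h <;>
  simp only [DualEdge.tt.injEq, DualEdge.tm.injEq, DualEdge.mb.injEq, DualEdge.bm.injEq,
    Fin.ext_iff, reduceCtorEq] <;>
  omega

/-- The set in the infimum is a singleton. A Bézout relation for one primitive vector makes its
scale an integer multiple of the other, and symmetrically; two non-negative scales that divide each
other agree. -/
theorem latticeLength_smul {L : ℝ} (hL : 0 ≤ L) {n : ℤ × ℤ} (hn : IsCoprime n.1 n.2) :
    latticeLength (L • toPlane n) = L := by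
  have key : ∀ {L L' : ℝ} {n n' : ℤ × ℤ}, IsCoprime n.1 n.2 → L • toPlane n = L' • toPlane n' →
      ∃ k : ℤ, L = L' * k := by
    rintro L L' n n' ⟨u, v, huv⟩ h
    have h1 := congrArg Prod.fst h
    have h2 := congrArg Prod.snd h
    simp only [toPlane, Prod.smul_fst, Prod.smul_snd, smul_eq_mul] at h1 h2
    refine ⟨u * n'.1 + v * n'.2, ?_⟩
    have huv' : (u : ℝ) * n.1 + v * n.2 = 1 := by exact_mod_cast huv
    push_cast
    calc L = L * (u * n.1 + v * n.2) := by rw [huv', mul_one]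
      _ = u * (L * n.1) + v * (L * n.2) := by ring
      _ = _ := by rw [h1, h2]; ring
  have hset : {L' : ℝ | 0 ≤ L' ∧ ∃ n' : ℤ × ℤ, IsCoprime n'.1 n'.2 ∧
      L • toPlane n = L' • toPlane n'} = {L} := by
    ext L'
    constructor
    · rintro ⟨hL', n', hn', h⟩
      obtain ⟨k, hk⟩ := key hn h
      obtain ⟨k', hk'⟩ := key hn' h.symm
      rw [Set.mem_singleton_iff]
      rcases hL.eq_or_lt with rfl | hpos
      · simpa using hk'
      · have hpos' : 0 < L' := by
          rcases hL'.eq_or_lt with rfl | h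
          · simp only [zero_mul] at hk; exact absurd hk hpos.ne'
          · exact h
        have hk1 : (1 : ℝ) ≤ k := by
          have : (0 : ℝ) < k := by
            by_contra hc
            nlinarith
          exact_mod_cast this
        have hk2 : (1 : ℝ) ≤ k' := by
          have : (0 : ℝ) < k' := by
            by_contra hc
            nlinarith
          exact_mod_cast this
        exact le_antisymm (by nlinarith) (by nlinarith)
    · rintro rfl
      exact ⟨hL, n, hn, rfl⟩
  unfold latticeLength
  rw [hset, csInf_singleton]

/-- The length of the bounded edge of the curve dual to an edge of the triangulation. -/
def dualLen (ω : ℤ × ℤ → ℝ) {g : ℕ} : DualEdge g → ℝ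
  | .tt j => slopeOne ω j - slopeOne ω (j + 1)
  | .tm j => gap ω j
  | .mb j => slopeOne ω j - slopeZero ω j
  | .bm j => slopeZero ω j - slopeOne ω (j + 1)

/-- The edge lengths of the skeleton of the curve. -/
def chainLen (ω : ℤ × ℤ → ℝ) {g : ℕ} : ChainEdge g → ℝ
  | .first => gap ω 0 + 2 * (slopeOne ω 0 - slopeOne ω 1)
  | .last => gap ω g + 2 * (slopeOne ω (g - 1) - slopeOne ω g)
  | .h j => gap ω (j + 1)
  | .u k => slopeOne ω (k + 1) - slopeOne ω (k + 2)
  | .w k => slopeOne ω (k + 1) - slopeOne ω (k + 2)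

/-- The equality `u = w` arises here: the two pieces of the lower path sum to `s j - s (j+1)`,
independently of `r j`. -/
theorem sum_concatFiber {g : ℕ} (hg : 2 ≤ g) (ω : ℤ × ℤ → ℝ) (x : ChainEdge g) :
    ∑ e ∈ concatFiber hg x, dualLen ω e = chainLen ω x := by
  rcases x with _ | _ | k | k | k <;>
    simp [concatFiber, dualLen, chainLen]
  · ring
  · rw [Nat.sub_add_cancel (by omega)]
    ring

namespace Admissible

variable {g : ℕ} {ω : ℤ × ℤ → ℝ}

theorem position_injective (H : Admissible g ω) : Function.Injective (position ω (g := g)) := by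
  intro v w h
  apply triangle_injective
  rw [← H.minTerms_position, ← H.minTerms_position, h]

/-- The bounded edge of the curve dual to an edge of the triangulation. -/
def boundedEdge (H : Admissible g ω) (e : DualEdge g) :
    BoundedEdge (latticePoints (polygonH g)) ω :=
  ⟨((dualGraph g).ends e).map (position ω), by
    obtain ⟨v, w, h, hne, hn⟩ := exists_ends_dualGraph e
    refine ⟨position ω v, position ω w, by rw [h]; rfl, H.position_injective.ne hne, ?_, ?_, ?_⟩
    · rw [H.curveVertices_eq]; exact ⟨v, rfl⟩
    · rw [H.curveVertices_eq]; exact ⟨w, rfl⟩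
    · rwa [H.minTerms_position, H.minTerms_position]⟩

theorem boundedEdge_bijective (H : Admissible g ω) : Function.Bijective H.boundedEdge := by
  constructor
  · intro e e' h
    exact ends_dualGraph_injective (Sym2.map.injective H.position_injective
      (congrArg Subtype.val h))
  · rintro ⟨z, p, q, rfl, hne, hp, hq, hn⟩
    rw [H.curveVertices_eq] at hp hq
    obtain ⟨v, rfl⟩ := hp
    obtain ⟨w, rfl⟩ := hq
    rw [H.minTerms_position, H.minTerms_position] at hn
    obtain ⟨e, he⟩ := exists_ends_of_nontrivial (fun h => hne (by rw [h])) hn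
    refine ⟨e, Subtype.ext ?_⟩
    change Sym2.map _ ((dualGraph g).ends e) = _
    rw [he]
    rfl

/-- The vectors `n` are primitive and orthogonal to the dual edges of the triangulation. For
instance `(-1, -(j+1))` is orthogonal to the edge from `(0,2)` to `(j+1,1)`. -/
theorem edgeLength_boundedEdge (H : Admissible g ω) (e : DualEdge g) :
    edgeLength (latticePoints (polygonH g)) ω (H.boundedEdge e) = dualLen ω e := by
  rcases e with ⟨j, hj⟩ | ⟨j, hj⟩ | ⟨j, hj⟩ | ⟨j, hj⟩
  · change latticeLength (position ω (.t _) - position ω (.t _)) = _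
    refine Eq.trans ?_ (latticeLength_smul (sub_nonneg.2 (H.slopeOne_succ_lt hj).le)
      (n := (-1, -(j + 1))) ⟨-1, 0, by simp⟩)
    congr 1
    ext
    · simp [position, toPlane]
    · simp only [position, toPlane, slopeOne, Fin.castSucc_mk, Fin.succ_mk, Prod.mk_sub_mk,
        Prod.smul_mk, smul_eq_mul]
      push_cast
      ring
  · change latticeLength (position ω (.m _) - position ω (.t _)) = _
    refine Eq.trans ?_ (latticeLength_smul (H.gap_pos j (by omega)).le (n := (0, 1)) ⟨0, 1, by simp⟩)
    congr 1
    ext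
    · simp [position, toPlane]
    · simp [position, toPlane, gap]
      ring
  · change latticeLength (position ω (.b _) - position ω (.m _)) = _
    refine Eq.trans ?_ (latticeLength_smul (sub_nonneg.2 (H.slopeZero_lt j (by omega)).le)
      (n := (-1, 1)) ⟨0, 1, by simp⟩)
    congr 1
    ext
    · simp [position, toPlane]
    · simp [position, toPlane, slopeOne, slopeZero]
      ring
  · change latticeLength (position ω (.m _) - position ω (.b _)) = _
    refine Eq.trans ?_ (latticeLength_smul (sub_nonneg.2 (H.lt_slopeZero j hj).le)
      (n := (-1, 0)) ⟨-1, 0, by simp⟩)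
    congr 1
    ext
    · simp [position, toPlane]
    · simp [position, toPlane]

/-- The skeleton of the tropical curve is the chain of loops. -/
theorem isSkeleton_curveGraph (H : Admissible g ω) (hg : 2 ≤ g) :
    (curveGraph (latticePoints (polygonH g)) ω).IsSkeleton
      (edgeLength (latticePoints (polygonH g)) ω) (chainGraph g hg) (chainLen ω) := by
  have h := isSkeleton_dualGraph hg (dualLen ω)
  simp only [sum_concatFiber] at h
  exact h.of_embedding (ε := Equiv.ofBijective _ H.boundedEdge_bijective) H.position_injective
    (fun e => rfl) H.edgeLength_boundedEdge

end Admissible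

/-! ### The chain of loops as a trivalent graph -/

theorem finsum_chainEdge {g : ℕ} {M : Type*} [AddCommMonoid M] (f : ChainEdge g → M) :
    ∑ᶠ e, f e = (f .first + f .last + ∑ j, f (.h j)) + (∑ k, f (.u k) + ∑ k, f (.w k)) := by
  rw [← finsum_comp_equiv (chainEdgeEquiv g), finsum_eq_sum_of_fintype, Fintype.sum_sum_type,
    Fintype.sum_sum_type, Fintype.sum_sum_type, Fintype.sum_bool]
  rfl

/-- The edges `first` and `last` replace the missing neighbours at the two ends of the chain. For `g
= 2` there is a single common edge and both are attached to it. -/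
theorem valence_chainGraph {g : ℕ} (hg : 2 ≤ g) (v : Fin (g - 1) × Bool) :
    (chainGraph g hg).valence Set.univ v = 3 := by
  have hends : ∀ (x : ChainEdge g) (a b : Fin (g - 1) × Bool),
      (chainGraph g hg).ends x = s(a, b) → (chainGraph g hg).endCount x v =
        (if a.1.1 = v.1.1 ∧ a.2 = v.2 then 1 else 0) +
        (if b.1.1 = v.1.1 ∧ b.2 = v.2 then 1 else 0) := by
    intro x a b h
    rw [Multigraph.endCount_eq h]
    simp only [Prod.ext_iff, Fin.ext_iff]
  unfold Multigraph.valence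
  simp only [Set.mem_univ, finsum_true, finsum_chainEdge]
  rw [hends .first _ _ rfl, hends .last _ _ rfl]
  simp only [fun j => hends (.h j) _ _ rfl, fun k => hends (.u k) _ _ rfl,
    fun k => hends (.w k) _ _ rfl, leftIdx, rightIdx]
  obtain ⟨⟨i, hi⟩, _ | _⟩ := v <;>
  simp only [and_true, and_false, if_false, Bool.false_eq_true, Bool.true_eq_false,
    Finset.sum_add_distrib, sum_fin_eq, sum_fin_succ_eq, Finset.sum_const_zero, zero_add, add_zero] <;>
  split_ifs <;> omega

theorem connected_chainGraph {g : ℕ} (hg : 2 ≤ g) (a b : Fin (g - 1) × Bool) :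
    Relation.ReflTransGen (fun a b => ∃ e, (chainGraph g hg).ends e = s(a, b)) a b := by
  set R : Fin (g - 1) × Bool → Fin (g - 1) × Bool → Prop :=
    fun a b => ∃ e, (chainGraph g hg).ends e = s(a, b) with hR
  have hsymm : ∀ a b, R a b → R b a := fun a b ⟨e, he⟩ => ⟨e, he.trans Sym2.eq_swap⟩
  have hup : ∀ j (hj : j < g - 1),
      Relation.ReflTransGen R (⟨0, by omega⟩, true) (⟨j, hj⟩, true) := by
    intro j
    induction j with
    | zero => exact fun _ => .refl
    | succ j ih => exact fun hj => (ih (by omega)).tail ⟨.u ⟨j, by omega⟩, rfl⟩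
  have hall : ∀ v, Relation.ReflTransGen R (⟨0, by omega⟩, true) v := by
    rintro ⟨⟨j, hj⟩, _ | _⟩
    · exact (hup j hj).tail ⟨.h ⟨j, hj⟩, rfl⟩
    · exact hup j hj
  have : Std.Symm R := ⟨hsymm⟩
  exact (Relation.ReflTransGen.stdSymm.symm _ _ (hall a)).trans (hall b)

theorem exists_chainTrivalent (g : ℕ) (hg : 2 ≤ g) : ∃ (G : TrivalentGraph g)
    (φ : ChainEdge g ≃ Fin (3 * g - 3)) (ψ : Fin (g - 1) × Bool ≃ Fin (2 * g - 2)),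
    (chainGraph g hg).IsIso G.toMultigraph φ ψ := by
  have φ : ChainEdge g ≃ Fin (3 * g - 3) := (chainEdgeEquiv g).symm.trans
    (Fintype.equivFinOfCardEq (by simp; omega))
  have ψ : Fin (g - 1) × Bool ≃ Fin (2 * g - 2) := Fintype.equivFinOfCardEq (by simp; omega)
  let M : Multigraph (Fin (2 * g - 2)) (Fin (3 * g - 3)) :=
    ⟨fun e => ((chainGraph g hg).ends (φ.symm e)).map ψ⟩
  have hM : (chainGraph g hg).IsIso M φ ψ := fun e => by simp [M]
  refine ⟨⟨M, fun v => ?_, fun u v => ?_⟩, φ, ψ, hM⟩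
  · obtain ⟨v, rfl⟩ := ψ.surjective v
    have h := Multigraph.valence_image ψ.injective hM Set.univ v
    rwa [Set.image_univ, φ.range_eq_univ, valence_chainGraph] at h
  · obtain ⟨u, rfl⟩ := ψ.surjective u
    obtain ⟨v, rfl⟩ := ψ.surjective v
    refine Relation.ReflTransGen.lift ψ ?_ _ _ (connected_chainGraph hg u v)
    rintro a b ⟨e, he⟩
    exact ⟨φ e, by rw [hM, he, Sym2.map_mk]⟩

/-! ### Realizable lengths -/

/-- The strict forms of the inequalities that define the cone. -/
def strictIneq (g : ℕ) (hg : 2 ≤ g) : Set (ChainEdge g → ℝ) :=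
  {m | m (.h ⟨0, by omega⟩) < m .first ∧ m .first < 2 * m (.h ⟨0, by omega⟩) ∧
    m (.h ⟨g - 2, by omega⟩) < m .last ∧
    ∀ k : Fin (g - 2),
      m (.h (leftIdx k)) + ((k : ℕ) + 2) * m (.u k) < m (.h (rightIdx k)) ∧
      m (.h (rightIdx k)) < m (.h (leftIdx k)) + ((k : ℕ) + 3) * m (.u k)}

/-- An identity valid for all heights. It carries all the length inequalities and also transports
positivity of the gaps. -/
theorem gap_succ (ω : ℤ × ℤ → ℝ) (j : ℕ) : gap ω (j + 1) =
    gap ω j + (j + 1) * (slopeOne ω j - slopeOne ω (j + 1)) + (slopeOne ω j - slopeZero ω j) := by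
  simp only [gap, slopeZero, slopeOne]
  push_cast
  ring

namespace Admissible

variable {g : ℕ} {ω : ℤ × ℤ → ℝ}

/-- The slacks of the outer conditions are `ℓ_s - h_1 = r 0 - s 1`, `2 h_1 - ℓ_s = gap 0 + 2 (s 0 -
r 0)` and `ℓ_e - h_{g-1} = (g+2) (s (g-1) - s g) + (s (g-1) - r (g-1))`. All are positive. The inner
conditions are `gap_succ` at index `k+1`. -/
theorem chainLen_mem (H : Admissible g ω) (hg : 2 ≤ g) : chainLen ω ∈ strictIneq g hg := by
  have e : g - 2 + 1 = g - 1 := by omega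
  refine ⟨?_, ?_, ?_, fun k => ⟨?_, ?_⟩⟩
  · have h1 := gap_succ ω 0
    have h2 := H.lt_slopeZero 0 (by omega)
    simp only [chainLen, zero_add, Nat.cast_zero] at *
    linarith
  · have h1 := gap_succ ω 0
    have h2 := H.slopeZero_lt 0 (by omega)
    have h3 := H.gap_pos 0 (by omega)
    simp only [chainLen, zero_add, Nat.cast_zero] at *
    linarith
  · have h1 := gap_succ ω (g - 1)
    have h2 := H.slopeOne_succ_lt (j := g - 1) (by omega)
    have h3 := H.slopeZero_lt (g - 1) (by omega)
    simp only [chainLen, e]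
    rw [Nat.sub_add_cancel (by omega)] at h1 h2
    have h4 := mul_pos (show (0 : ℝ) < (g - 1 : ℕ) + 1 by positivity) (sub_pos.2 h2)
    linarith
  · have h1 := gap_succ ω (k + 1)
    have h3 := H.slopeZero_lt (k + 1) (by omega)
    simp only [chainLen, leftIdx, rightIdx]
    push_cast at h1
    linarith
  · have h1 := gap_succ ω (k + 1)
    have h3 := H.lt_slopeZero (k + 1) (by omega)
    simp only [chainLen, leftIdx, rightIdx]
    push_cast at h1
    linarith

theorem chainLen_nonneg (H : Admissible g ω) (hg : 2 ≤ g) (x : ChainEdge g) :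
    0 ≤ chainLen ω x := by
  rw [← sum_concatFiber hg]
  refine Finset.sum_nonneg fun e _ => ?_
  rcases e with ⟨j, hj⟩ | ⟨j, hj⟩ | ⟨j, hj⟩ | ⟨j, hj⟩
  · exact (sub_pos.2 (H.slopeOne_succ_lt hj)).le
  · exact (H.gap_pos j (by omega)).le
  · exact (sub_pos.2 (H.slopeZero_lt j (by omega))).le
  · exact (sub_pos.2 (H.lt_slopeZero j hj)).le

end Admissible

/-- Heights with prescribed horizontal distances of the vertices of the curve. -/
theorem exists_heights (U d : ℕ → ℝ) (h₀ : ℝ) : ∃ ω : ℤ × ℤ → ℝ,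
    (∀ j, slopeOne ω j - slopeOne ω (j + 1) = U j) ∧ (∀ j, slopeOne ω j - slopeZero ω j = d j) ∧
    gap ω 0 = h₀ := by
  -- Adding an affine function to the heights changes none of the prescribed quantities, so `s 0`,
  -- `a 0` and the height of `(0,2)` are normalized to zero. Then `gap ω 0` is `b 0`.
  let s : ℕ → ℝ := fun j => -∑ i ∈ Finset.range j, U i
  let a : ℕ → ℝ := fun j => -∑ i ∈ Finset.range j, s i
  let b : ℕ → ℝ := fun j => h₀ - ∑ i ∈ Finset.range j, (s i - d i)
  let ω : ℤ × ℤ → ℝ := fun x => if x.2 = 1 then a x.1.toNat else if x.2 = 0 then b x.1.toNat else 0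
  have h1 : ∀ j, rowOne ω j = a j := fun j => by simp [rowOne, ω]
  have h0 : ∀ j, rowZero ω j = b j := fun j => by simp [rowZero, ω]
  have hs : ∀ j, slopeOne ω j = s j := fun j => by
    simp only [slopeOne, h1, a, Finset.sum_range_succ]; ring
  have hr : ∀ j, slopeZero ω j = s j - d j := fun j => by
    simp only [slopeZero, h0, b, Finset.sum_range_succ]; ring
  refine ⟨ω, fun j => ?_, fun j => ?_, ?_⟩
  · simp only [hs, s, Finset.sum_range_succ]; ring
  · rw [hs, hr]; ring
  · have hc : ω (0, 2) = 0 := by simp [ω]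
    simp only [gap, h1, h0, hc, a, b]
    simp

/-- Only the first gap has to be assumed positive, because by `gap_succ` the gaps increase. -/
theorem admissible_of_slopes {g : ℕ} {ω : ℤ × ℤ → ℝ} (h₀ : 0 < gap ω 0)
    (hd : ∀ j ≤ g, 0 < slopeOne ω j - slopeZero ω j)
    (hU : ∀ j < g, slopeOne ω j - slopeZero ω j < slopeOne ω j - slopeOne ω (j + 1)) :
    Admissible g ω := by
  refine ⟨fun j => ?_, fun j hj => sub_pos.1 (hd j hj), fun j hj => ?_⟩
  · induction j with
    | zero => exact fun _ => h₀
    | succ j ih =>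
      intro hj
      have h1 := ih (by omega)
      have h2 := hd j (by omega)
      have h3 := hU j (by omega)
      have h4 := mul_pos (show (0 : ℝ) < (j : ℝ) + 1 by positivity) (h2.trans h3)
      rw [gap_succ]
      linarith
  · have := hU j hj
    linarith

/-- All lengths satisfying the strict inequalities are lengths of skeletons. -/
theorem exists_admissible {g : ℕ} (hg : 2 ≤ g) {m : ChainEdge g → ℝ} (hm : m ∈ strictIneq g hg)
    (huw : ∀ k, m (.u k) = m (.w k)) : ∃ ω, Admissible g ω ∧ chainLen ω = m := by
  obtain ⟨h1, h2, h3, h4⟩ := hm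
  set p : ℝ := m .first - m (.h ⟨0, by omega⟩) with hp
  set q : ℝ := 2 * m (.h ⟨0, by omega⟩) - m .first with hq
  -- At the right end `U (g-1) = t` and `d (g-1) = t/2` are chosen, so the slack `(g+2) U + d`
  -- equals `(g + 5/2) t`.
  set t : ℝ := (m .last - m (.h ⟨g - 2, by omega⟩)) / (g + 5 / 2) with ht
  have hp0 : 0 < p := sub_pos.2 h1
  have hq0 : 0 < q := sub_pos.2 h2
  have ht0 : 0 < t := div_pos (sub_pos.2 h3) (by positivity)
  -- At the left end the requirements are `U 0 - d 0 = p` and `gap 0 + 2 * d 0 = q`; the choice `d 0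
  -- = q/4`, `gap 0 = q/2` splits `q` evenly. Inside, `U` and `d` are forced by `m`.
  let U : ℕ → ℝ := fun j => if j = 0 then p + q / 4 else
    if h : j - 1 < g - 2 then m (.u ⟨j - 1, h⟩) else t
  let d : ℕ → ℝ := fun j => if j = 0 then q / 4 else
    if h : j - 1 < g - 2 then m (.h (rightIdx ⟨j - 1, h⟩)) - m (.h (leftIdx ⟨j - 1, h⟩)) -
      ((j - 1 : ℕ) + 2) * m (.u ⟨j - 1, h⟩) else t / 2
  have hU0 : U 0 = p + q / 4 := rfl
  have hd0 : d 0 = q / 4 := rfl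
  have hUk : ∀ k (hk : k < g - 2), U (k + 1) = m (.u ⟨k, hk⟩) := fun k hk => by simp [U, hk]
  have hdk : ∀ k (hk : k < g - 2), d (k + 1) = m (.h (rightIdx ⟨k, hk⟩)) -
      m (.h (leftIdx ⟨k, hk⟩)) - (k + 2) * m (.u ⟨k, hk⟩) := fun k hk => by simp [d, hk]
  have hUg : ∀ k, g - 2 ≤ k → U (k + 1) = t := fun k hk => by simp [U, not_lt.2 hk]
  have hdg : ∀ k, g - 2 ≤ k → d (k + 1) = t / 2 := fun k hk => by simp [d, not_lt.2 hk]
  have hpos : ∀ j, 0 < d j ∧ d j < U j := by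
    rintro (_ | k)
    · rw [hU0, hd0]; constructor <;> linarith
    · by_cases hk : k < g - 2
      · have h5 := h4 ⟨k, hk⟩
        simp only at h5
        rw [hUk k hk, hdk k hk]
        constructor <;> linarith
      · rw [hUg k (not_lt.1 hk), hdg k (not_lt.1 hk)]
        constructor <;> linarith
  obtain ⟨ω, hω1, hω2, hω3⟩ := exists_heights U d (q / 2)
  have H : Admissible g ω := admissible_of_slopes (by rw [hω3]; linarith)
    (fun j _ => by rw [hω2]; exact (hpos j).1) (fun j _ => by rw [hω1, hω2]; exact (hpos j).2)
  have hgap : ∀ j (hj : j < g - 1), gap ω (j + 1) = m (.h ⟨j, hj⟩) := by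
    intro j
    induction j with
    | zero =>
      intro hj
      rw [gap_succ, hω1, hω2, hω3, hU0, hd0]
      push_cast
      linarith
    | succ j ih =>
      intro hj
      rw [gap_succ, hω1, hω2, ih (by omega), hUk j (by omega), hdk j (by omega)]
      simp only [leftIdx, rightIdx]
      push_cast
      ring
  refine ⟨ω, H, ?_⟩
  funext x
  rcases x with _ | _ | ⟨j, hj⟩ | ⟨k, hk⟩ | ⟨k, hk⟩
  · simp only [chainLen]
    rw [hω3, hω1, hU0]
    linarith
  · obtain ⟨n, rfl⟩ : ∃ n, g = n + 2 := ⟨g - 2, by omega⟩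
    have e1 : n + 2 - 1 = n + 1 := rfl
    have e2 : n + 2 - 2 = n := rfl
    simp only [chainLen, e1]
    rw [gap_succ, hω1, hω2, hgap n (by omega), hUg n (by omega), hdg n (by omega)]
    have h6 : t * (((n + 2 : ℕ) : ℝ) + 5 / 2) = m .last - m (.h ⟨n, by omega⟩) :=
      div_mul_cancel₀ _ (by positivity)
    push_cast at h6 ⊢
    linarith
  · exact hgap j hj
  · simp only [chainLen]
    rw [← hUk k hk]
    exact hω1 (k + 1)
  · simp only [chainLen]
    rw [← huw, ← hUk k hk]
    exact hω1 (k + 1)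

/-- Particular lengths satisfying the strict inequalities. -/
def interiorLen (g : ℕ) : ChainEdge g → ℝ≥0
  | .first => 5
  | .last => (g : ℝ≥0) ^ 2 + 1
  | .h j => ((j : ℕ) + 2) ^ 2
  | .u _ => 2
  | .w _ => 2

theorem mem_chainCone_iff {g : ℕ} (hg : 2 ≤ g) {m : ChainEdge g → ℝ≥0} : m ∈ chainCone g hg ↔
    (∀ k : Fin (g - 2), m (.u k) = m (.w k)) ∧
    ((m (.h ⟨0, by omega⟩) : ℝ) ≤ m .first ∧ (m .first : ℝ) ≤ 2 * m (.h ⟨0, by omega⟩)) ∧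
    (m (.h ⟨g - 2, by omega⟩) : ℝ) ≤ m .last ∧
    ∀ k : Fin (g - 2),
      (m (.h (leftIdx k)) : ℝ) + ((k : ℕ) + 2) * m (.u k) ≤ m (.h (rightIdx k)) ∧
      (m (.h (rightIdx k)) : ℝ) ≤ m (.h (leftIdx k)) + ((k : ℕ) + 3) * m (.u k) := by
  simp only [chainCone, Set.mem_ofPred_eq, ← NNReal.coe_le_coe, NNReal.coe_add, NNReal.coe_mul,
    NNReal.coe_natCast, NNReal.coe_ofNat]

theorem mem_chainCone_of_strict {g : ℕ} (hg : 2 ≤ g) {m : ChainEdge g → ℝ≥0}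
    (hm : (fun x => (m x : ℝ)) ∈ strictIneq g hg) (huw : ∀ k, m (.u k) = m (.w k)) :
    m ∈ chainCone g hg := by
  obtain ⟨h1, h2, h3, h4⟩ := hm
  exact (mem_chainCone_iff hg).2
    ⟨huw, ⟨h1.le, h2.le⟩, h3.le, fun k => ⟨(h4 k).1.le, (h4 k).2.le⟩⟩

/-- The squares in `interiorLen` work because, with `u_j = 2` and `h_j = (j+1)^2`, the increment
`h_j - h_{j-1} = 2j+1` lies strictly between `j u_j` and `(j+1) u_j`. Likewise `4 < 5 < 8` and `g^2
< g^2 + 1`. -/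
theorem add_interiorLen_mem {g : ℕ} (hg : 2 ≤ g) {m : ChainEdge g → ℝ≥0} (hm : m ∈ chainCone g hg)
    {ε : ℝ≥0} (hε : 0 < ε) :
    (fun x => ((m x + ε * interiorLen g x : ℝ≥0) : ℝ)) ∈ strictIneq g hg := by
  obtain ⟨h1, ⟨h2, h3⟩, h4, h5⟩ := (mem_chainCone_iff hg).1 hm
  have hε' : (0 : ℝ) < ε := hε
  refine ⟨?_, ?_, ?_, fun k => ⟨?_, ?_⟩⟩
  · simp only [interiorLen]
    push_cast
    linarith
  · simp only [interiorLen]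
    push_cast
    linarith
  · obtain ⟨n, rfl⟩ : ∃ n, g = n + 2 := ⟨g - 2, by omega⟩
    simp only [interiorLen, Nat.add_sub_cancel] at *
    push_cast
    linarith
  · have := (h5 k).1
    simp only [interiorLen, leftIdx, rightIdx] at *
    push_cast
    nlinarith
  · have := (h5 k).2
    simp only [interiorLen, leftIdx, rightIdx] at *
    push_cast
    nlinarith

theorem zero_mem_chainCone (g : ℕ) (hg : 2 ≤ g) : (0 : ChainEdge g → ℝ≥0) ∈ chainCone g hg := by
  simp [chainCone]

theorem interiorLen_mem (g : ℕ) (hg : 2 ≤ g) :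
    (fun x => (interiorLen g x : ℝ)) ∈ strictIneq g hg := by
  simpa using add_interiorLen_mem hg (zero_mem_chainCone g hg) one_pos

theorem isClosed_chainCone (g : ℕ) (hg : 2 ≤ g) : IsClosed (chainCone g hg) := by
  simp only [chainCone, Set.ofPred_and, Set.ofPred_forall]
  refine IsClosed.inter (isClosed_iInter fun k => isClosed_eq ?_ ?_)
    (IsClosed.inter (IsClosed.inter (isClosed_le ?_ ?_) (isClosed_le ?_ ?_))
      (IsClosed.inter (isClosed_le ?_ ?_) (isClosed_iInter fun k =>
        IsClosed.inter (isClosed_le ?_ ?_) (isClosed_le ?_ ?_)))) <;> fun_prop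

theorem isOpen_strictIneq (g : ℕ) (hg : 2 ≤ g) : IsOpen (strictIneq g hg) := by
  simp only [strictIneq, Set.ofPred_and, Set.ofPred_forall]
  refine IsOpen.inter (isOpen_lt ?_ ?_) (IsOpen.inter (isOpen_lt ?_ ?_)
    (IsOpen.inter (isOpen_lt ?_ ?_) (isOpen_iInter_of_finite fun k =>
        IsOpen.inter (isOpen_lt ?_ ?_) (isOpen_lt ?_ ?_)))) <;> fun_prop

variable {g : ℕ}

/-! ### The space of the triangulation -/

/-- The lengths of the skeleton of a curve as non-negative numbers. -/
def Admissible.chainLenNN {ω : ℤ × ℤ → ℝ} (H : Admissible g ω) (hg : 2 ≤ g) (x : ChainEdge g) :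
    ℝ≥0 := ⟨chainLen ω x, H.chainLen_nonneg hg x⟩

theorem Admissible.isCurveSkeleton {ω : ℤ × ℤ → ℝ} (H : Admissible g ω) (hg : 2 ≤ g)
    {G : TrivalentGraph g} {φ : ChainEdge g ≃ Fin (3 * g - 3)}
    {ψ : Fin (g - 1) × Bool ≃ Fin (2 * g - 2)}
    (hiso : (chainGraph g hg).IsIso G.toMultigraph φ ψ) {ℓ : Fin (3 * g - 3) → ℝ≥0}
    (hℓ : ∀ x, (ℓ (φ x) : ℝ) = chainLen ω x) : IsCurveSkeleton (polygonH g) ω G ℓ :=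
  (H.isSkeleton_curveGraph hg).of_isIso hiso hℓ

theorem Admissible.exists_isCurveSkeleton {ω : ℤ × ℤ → ℝ} (H : Admissible g ω) (hg : 2 ≤ g) :
    ∃ (G : TrivalentGraph g) (ℓ : Fin (3 * g - 3) → ℝ≥0), IsCurveSkeleton (polygonH g) ω G ℓ := by
  obtain ⟨G, φ, ψ, hiso⟩ := exists_chainTrivalent g hg
  refine ⟨G, fun e => H.chainLenNN hg (φ.symm e), H.isCurveSkeleton hg hiso fun x => ?_⟩
  rw [φ.symm_apply_apply]
  rfl

theorem Admissible.exists_isIso {ω : ℤ × ℤ → ℝ} (H : Admissible g ω) (hg : 2 ≤ g)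
    {G : TrivalentGraph g} {ℓ : Fin (3 * g - 3) → ℝ≥0}
    (h : IsCurveSkeleton (polygonH g) ω G ℓ) :
    ∃ (φ : ChainEdge g ≃ Fin (3 * g - 3)) (ψ : Fin (g - 1) × Bool ≃ Fin (2 * g - 2)),
      (chainGraph g hg).IsIso G.toMultigraph φ ψ ∧ ∀ x, (ℓ (φ x) : ℝ) = chainLen ω x :=
  (H.isSkeleton_curveGraph hg).unique h

theorem exists_induces (hg : 2 ≤ g) : ∃ ω, Induces (polygonH g) ω (triangulationH g) := by
  obtain ⟨ω, H, -⟩ := exists_admissible hg (interiorLen_mem g hg) fun k => rfl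
  exact ⟨ω, H.induces⟩

theorem triangulationModuli_eq (hg : 2 ≤ g) :
    triangulationModuli g (polygonH g) (triangulationH g) =
      chainLocus g hg (chainCone g hg) := by
  apply Set.Subset.antisymm
  · refine closure_minimal ?_ (isClosed_chainLocus g hg (isClosed_chainCone g hg))
    rintro _ ⟨ω, G, ℓ, hind, hsk, rfl⟩
    have H := hind.admissible
    obtain ⟨φ, ψ, hiso, hlen⟩ := H.exists_isIso hg hsk
    refine ⟨G, ℓ, φ, ψ, hiso, mem_chainCone_of_strict hg ?_ fun k => ?_, rfl⟩
    · simp only [hlen]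
      exact H.chainLen_mem hg
    · rw [← NNReal.coe_inj, hlen, hlen]
      rfl
  · rintro _ ⟨G, ℓ, φ, ψ, hiso, hmem, rfl⟩
    -- The path moves into the interior of the cone while keeping `u = w`. Its points with positive
    -- parameter are skeletons and tend to the given point.
    let c : ℝ≥0 → Fin (3 * g - 3) → ℝ≥0 := fun ε e => ℓ e + ε * interiorLen g (φ.symm e)
    have hc : Continuous c := by
      refine continuous_pi fun e => ?_
      simp only [c]
      fun_prop
    have ht : Filter.Tendsto (fun n : ℕ => Moduli.point G (c (1 / ((n : ℝ≥0) + 1)))) Filter.atTop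
        (nhds (Moduli.point G ℓ)) := by
      have h0 : Moduli.point G ℓ = Moduli.point G (c 0) := by simp [c]
      rw [h0]
      exact (((continuous_point G).comp hc).tendsto 0).comp
        (tendsto_one_div_add_atTop_nhds_zero_nat (𝕜 := ℝ≥0))
    refine mem_closure_of_tendsto ht (Filter.Eventually.of_forall fun n => ?_)
    obtain ⟨ω, H, hω⟩ := exists_admissible hg
      (add_interiorLen_mem hg hmem (ε := 1 / ((n : ℝ≥0) + 1)) (by positivity))
      (fun k => by simp only [hmem.1 k]; rfl)
    refine ⟨ω, G, _, H.induces, H.isCurveSkeleton hg hiso fun x => ?_, rfl⟩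
    rw [hω]
    simp [c]

/-! ### The dimension -/

/-- Independent coordinates on the linear span of the cone. -/
abbrev FreeEdge (g : ℕ) : Type := (Bool ⊕ Fin (g - 1)) ⊕ Fin (g - 2)

/-- The edge that carries an independent coordinate. -/
def freeEdge : FreeEdge g → ChainEdge g
  | .inl (.inl true) => .first
  | .inl (.inl false) => .last
  | .inl (.inr j) => .h j
  | .inr k => .u k

/-- The coordinate that gives the length of an edge. -/
def coordOf : ChainEdge g → FreeEdge g
  | .first => .inl (.inl true)
  | .last => .inl (.inl false)
  | .h j => .inl (.inr j)
  | .u k => .inr k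
  | .w k => .inr k

theorem coordOf_freeEdge (i : FreeEdge g) : coordOf (freeEdge i) = i := by
  rcases i with ((_ | _) | _) | _ <;> rfl

theorem card_freeEdge (hg : 2 ≤ g) : Fintype.card (FreeEdge g) = 2 * g - 1 := by
  simp
  omega

theorem freeEdge_coordOf {m : ChainEdge g → ℝ≥0} (huw : ∀ k, m (.u k) = m (.w k))
    (x : ChainEdge g) : m (freeEdge (coordOf x)) = m x := by
  rcases x with _ | _ | j | k | k <;> first | rfl | exact huw k

theorem lipschitzWith_pi_of {X ι : Type*} [PseudoMetricSpace X] [Fintype ι] {Y : ι → Type*}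
    [∀ i, PseudoMetricSpace (Y i)] {f : X → ∀ i, Y i} (h : ∀ i, LipschitzWith 1 fun x => f x i) :
    LipschitzWith 1 f := by
  refine LipschitzWith.of_dist_le_mul fun x y => ?_
  rw [dist_pi_le_iff (by positivity)]
  exact fun i => (h i).dist_le_mul x y

/-- The inverse image may contain degenerate points coming from other gluings, but it is covered by
finitely many 1-Lipschitz images of a space of dimension `2g - 1`. -/
theorem dimH_chainLocus_le (hg : 2 ≤ g) (G : TrivalentGraph g) :
    dimH {ℓ | Moduli.point G ℓ ∈ chainLocus g hg (chainCone g hg)} ≤ ((2 * g - 1 : ℕ) : ℝ≥0∞) := by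
  -- Truncation by `Real.toNNReal` makes the parametrization total and keeps it 1-Lipschitz; on
  -- actual lengths it does nothing.
  let F : (Fin (3 * g - 3) → Option (Fin (3 * g - 3))) × (ChainEdge g ≃ Fin (3 * g - 3)) →
      (FreeEdge g → ℝ) → Fin (3 * g - 3) → ℝ≥0 := fun d x =>
    MetricModel.pullLen d.1 fun e => (x (coordOf (d.2.symm e))).toNNReal
  have hF : ∀ d, LipschitzWith 1 (F d) := by
    intro d
    refine lipschitzWith_pi_of fun e => ?_
    simp only [F, MetricModel.pullLen]
    cases d.1 e with
    | none => exact LipschitzWith.const' 0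
    | some e' =>
      have := Real.lipschitzWith_toNNReal.comp
        (LipschitzWith.eval (α := fun _ : FreeEdge g => ℝ) (coordOf (d.2.symm e')))
      rw [one_mul] at this
      exact this
  have hsub : {ℓ | Moduli.point G ℓ ∈ chainLocus g hg (chainCone g hg)} ⊆
      ⋃ d, Set.range (F d) := by
    rintro ℓ ⟨C, m, φ, ψ, hiso, hmem, hx⟩
    obtain ⟨f, hf, -⟩ := (point_eq_point_iff.1 hx.symm).exists_pullLen
    refine Set.mem_iUnion.2 ⟨(f, φ), fun i => (m (φ (freeEdge i)) : ℝ), ?_⟩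
    rw [hf]
    simp only [F, Real.toNNReal_coe]
    congr 1
    funext e
    rw [freeEdge_coordOf (m := fun a => m (φ a)) hmem.1, φ.apply_symm_apply]
  refine (dimH_mono hsub).trans ?_
  rw [dimH_iUnion]
  refine iSup_le fun d => (hF d).dimH_range_le.trans ?_
  rw [Real.dimH_univ_pi, card_freeEdge hg]

theorem exists_le_dimH_chainLocus (hg : 2 ≤ g) : ∃ G : TrivalentGraph g, ((2 * g - 1 : ℕ) : ℝ≥0∞) ≤
    dimH {ℓ | Moduli.point G ℓ ∈ chainLocus g hg (chainCone g hg)} := by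
  obtain ⟨G, φ, ψ, hiso⟩ := exists_chainTrivalent g hg
  refine ⟨G, ?_⟩
  let O : Set (FreeEdge g → ℝ) := (fun x a => x (coordOf a)) ⁻¹' strictIneq g hg
  have hO : IsOpen O := (isOpen_strictIneq g hg).preimage (by fun_prop)
  have hne : O.Nonempty := by
    refine ⟨fun i => (interiorLen g (freeEdge i) : ℝ), ?_⟩
    have := interiorLen_mem g hg
    simp only [O, Set.mem_preimage, freeEdge_coordOf (m := interiorLen g) fun _ => rfl]
    exact this
  have hdim : dimH O = ((2 * g - 1 : ℕ) : ℝ≥0∞) := by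
    rw [Real.dimH_of_nonempty_interior (by rwa [hO.interior_eq]), Module.finrank_fintype_fun_eq_card,
      card_freeEdge hg]
  -- Reading off the free coordinates is 1-Lipschitz and maps the inverse image onto a set
  -- containing the non-empty open set `O`, which has full dimension.
  let R : (Fin (3 * g - 3) → ℝ≥0) → FreeEdge g → ℝ := fun ℓ i => ℓ (φ (freeEdge i))
  have hR : LipschitzWith 1 R := by
    refine lipschitzWith_pi_of fun i => ?_
    have := (isometry_subtype_coe (s := Set.Ici (0 : ℝ))).lipschitz.comp
      (LipschitzWith.eval (α := fun _ : Fin (3 * g - 3) => ℝ≥0) (φ (freeEdge i)))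
    rw [one_mul] at this
    exact this
  rw [← hdim]
  refine (dimH_mono ?_).trans (hR.dimH_image_le _)
  intro x hx
  obtain ⟨ω, H, hω⟩ := exists_admissible hg (m := fun a => x (coordOf a)) hx fun k => rfl
  refine ⟨fun e => H.chainLenNN hg (φ.symm e), ?_, ?_⟩
  · refine ⟨G, _, φ, ψ, hiso, ?_, rfl⟩
    simp only [φ.symm_apply_apply]
    refine mem_chainCone_of_strict hg (H.chainLen_mem hg) fun k => rfl
  · funext i
    simp only [R, φ.symm_apply_apply]
    change chainLen ω (freeEdge i) = x i
    rw [hω]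
    exact congrArg x (coordOf_freeEdge i)

theorem dim_chainLocus (hg : 2 ≤ g) :
    Moduli.dim (chainLocus g hg (chainCone g hg)) = ((2 * g - 1 : ℕ) : ℝ≥0∞) := by
  refine le_antisymm (iSup_le fun G => dimH_chainLocus_le hg G) ?_
  obtain ⟨G, hG⟩ := exists_le_dimH_chainLocus hg
  exact le_iSup_of_le G hG

end TropPlane

theorem proposition6p2 (g : ℕ) (hg : 2 ≤ g) :
    -- the triangulation is regular
    (∃ ω : ℤ × ℤ → ℝ, TropPlane.Induces (TropPlane.polygonH g) ω (TropPlane.triangulationH g)) ∧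
    -- each dual tropical curve has a skeleton, and it is a bridgeless chain of loops
    (∀ ω : ℤ × ℤ → ℝ,
      TropPlane.Induces (TropPlane.polygonH g) ω (TropPlane.triangulationH g) →
      (∃ (G : TropPlane.TrivalentGraph g) (ℓ : Fin (3 * g - 3) → NNReal),
        TropPlane.IsCurveSkeleton (TropPlane.polygonH g) ω G ℓ) ∧
      ∀ (G : TropPlane.TrivalentGraph g) (ℓ : Fin (3 * g - 3) → NNReal),
        TropPlane.IsCurveSkeleton (TropPlane.polygonH g) ω G ℓ →
        ∃ (φ : TropPlane.ChainEdge g ≃ Fin (3 * g - 3))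
          (ψ : Fin (g - 1) × Bool ≃ Fin (2 * g - 2)),
          (TropPlane.chainGraph g hg).IsIso G.toMultigraph φ ψ) ∧
    -- the equalities and inequalities that define the space
    TropPlane.triangulationModuli g (TropPlane.polygonH g) (TropPlane.triangulationH g) =
      TropPlane.chainLocus g hg (TropPlane.chainCone g hg) ∧
    -- its dimension
    TropPlane.Moduli.dim
      (TropPlane.triangulationModuli g (TropPlane.polygonH g) (TropPlane.triangulationH g)) =
      ((2 * g - 1 : ℕ) : ENNReal) := by
  refine ⟨TropPlane.exists_induces hg, fun ω h => ⟨h.admissible.exists_isCurveSkeleton hg,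
    fun G ℓ hs => ?_⟩, TropPlane.triangulationModuli_eq hg, ?_⟩
  · obtain ⟨φ, ψ, hiso, -⟩ := h.admissible.exists_isIso hg hs
    exact ⟨φ, ψ, hiso⟩
  · rw [TropPlane.triangulationModuli_eq hg]
    exact TropPlane.dim_chainLocus hg
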